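/- Let $d\ge 2$, let $\Omega\subset\mathbb{R}^d$ be a bounded Lipschitz domain, and let $r\ge 1$. For $h$ in an index set $H\subset(0,\infty)$ let $\mathcal{T}_h$ be a conforming simplicial mesh of $\overline\Omega$ with mesh size $h=\max_{\mathcal K\in\mathcal T_h} h_{\mathcal K}$, $h_{\mathcal K}=\operatorname{diam}\mathcal K$. Assume that the family is regular ($h_{\mathcal K}\le\sigma\rho_{\mathcal K}$ for all $h\in H$, $\mathcal K\in\mathcal T_h$, where $\rho_{\mathcal K}$ is the largest diameter of a ball contained in $\mathcal K$) and quasi-uniform ($h_{\mathcal K}\ge\tau h$ for all $h\in H$, $\mathcal K\in\mathcal T_h$), with constants $\sigma$ and $\tau>0$ independent of $h$. Let $V_h$ be the space of continuous functions on $\overline\Omega$ which on each $\mathcal K\in\mathcal T_h$ are polynomials of degree at most $r$. The FE-interpolant of a function $w:\overline\Omega\to\mathbb{R}$ is the element of $V_h$ with the same values as $w$ at all Lagrange nodes, i.e. at the points of the elements whose barycentric coordinates are integer multiples of $1/r$. **Admissible methods.** Let $I_\delta$ ($\delta\in H$) be linear maps from functions on $\overline\Omega$ into spaces $V^\delta\subset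 H^1(\Omega)$. A *pointwise extension* of $\chi_A$ is a function $f:\overline\Omega\to\{0,1\}$ with $x\in\overline A$ if $f(x)=1$ and $x\in\overline{\Omega\setminus\overline A}$ if $f(x)=0$; thus $f=\chi_A$ off $\partial A$. The method $\{I_\delta\}$ is *admissible* if for every Lipschitz domain $A\subset\Omega$ and every pointwise extension $f$ of $\chi_A$, with $U_\delta=\{x\in\Omega:\operatorname{dist}(x,\partial A\cap\Omega)<\delta\}$ (empty if $\partial A\cap\Omega=\emptyset$): 1. $\|I_\delta f-\chi_A\|_{L^2(\Omega)}\to 0$ as $\delta\to 0$ in $H$; 2. $\nabla I_\delta f\in L^\infty(\Omega)$ and $\operatorname{supp}\nabla I_\delta f\subset\overline{U_\delta}$ for all $\delta\in H$; 3. there is a constant $C$ such that $\delta\,\|\nabla I_\delta f\|_{L^\infty(\Omega)}\le C$ for all sufficiently small $\delta\in H$; 4. for all $\delta\in H$ and all $\Gamma\subset\partial\Omega\setminus\partial U_\delta$ with $\mathcal H^{d-1}(\Gamma)>0$, the traces of $\chi_A$ and of $I_\delta f$ on $\Gamma$ coincide. **Media.** Let $u=\sum_{m=1}^M\omega_m\chi_{\Omega^m}+\sum_{k=1}^K\alpha_k\chi_{A^k}$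 with $\omega_m\in\mathbb R$, $\alpha_k\in\mathbb R\setminus\{0\}$. Here the $\Omega^m$ are disjoint Lipschitz domains with $\overline\Omega=\bigcup_m\overline{\Omega^m}$, and $\Omega^m=\Omega\cap\widetilde\Omega^m$, $\partial\Omega\cap\widetilde\Omega^m\ne\emptyset$, for some disjoint bounded Lipschitz domains $\widetilde\Omega^m$; the $A^k$ are Lipschitz domains with connected, mutually disjoint boundaries, each compactly contained in some $\Omega^m$. Extend $u$ to $\overline\Omega$ either (a) by giving it at each point of the interfaces (the union of all $\partial\Omega^m$ and $\partial A^k$) one of its values in a neighbouring domain, or (b) by replacing all $\Omega^m$, $A^k$ in the formula for $u$ by their closures. A family $u_\delta$ ($\delta\in H$) is an *admissible approximation* of $u$ if $u_\delta=\sum_m\omega_m I_\delta b_m+\sum_k\alpha_k I_\delta a_k$ for an admissible method $\{I_\delta\}$ and some pointwise extensions $b_m$ of $\chi_{\Omega^m}$ and $a_k$ of $\chi_{A^k}$. **Proposition 2.2.** For every $h\in H$ every function on $\overline\Omega$ has exactly one FE-interpolant in $V_h$. Interpolation in $V_h$ is an admissible method with $\delta=h$ and $V^h=V_h$; in particular $V_h\subset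 H^1(\Omega)$ and, for every Lipschitz domain $A\subset\Omega$ and every pointwise extension of $\chi_A$ with interpolants $I_h\chi_A$, there is a constant $C$ with $h\|\nabla I_h\chi_A\|_{L^\infty(\Omega)}\le C$ for all sufficiently small $h\in H$. For every $u$ as above, extended as in (a) or (b), the FE-interpolants $u_h$ of $u$ are an admissible approximation of $u$ with $\delta=h$. -/

import Mathlib

open MeasureTheory Set Filter Topology
open scoped ENNReal NNReal ContDiff

noncomputable section

/-! ### Lipschitz domains, Sobolev space `H¹`, traces -/

/-- A Lipschitz domain: a (nonempty) connected open set which, near each boundary point, coincides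
in some Cartesian coordinate system `(ξ, η)` with the epigraph `{η > f ξ}` of a Lipschitz
function `f`. Here `η = ⟪e, y⟫` for a unit vector `e`, and `ξ = y - ⟪e, y⟫ e` is the component of
`y` in the hyperplane orthogonal to `e` (`f` is only evaluated on this hyperplane). -/
def IsLipschitzDomain {d : ℕ} (A : Set (EuclideanSpace ℝ (Fin d))) : Prop :=
  IsOpen A ∧ IsConnected A ∧
    ∀ x ∈ frontier A, ∃ (V : Set (EuclideanSpace ℝ (Fin d))) (e : EuclideanSpace ℝ (Fin d))
      (L : ℝ≥0) (f : EuclideanSpace ℝ (Fin d) → ℝ),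
      IsOpen V ∧ x ∈ V ∧ ‖e‖ = 1 ∧ LipschitzWith L f ∧
        ∀ y ∈ V, y ∈ A ↔ f (y - inner ℝ e y • e) < inner ℝ e y

/-- `g` is the weak (distributional) gradient of `v` in the open set `Ω`. -/
def HasWeakGradient {d : ℕ} (Ω : Set (EuclideanSpace ℝ (Fin d)))
    (v : EuclideanSpace ℝ (Fin d) → ℝ)
    (g : EuclideanSpace ℝ (Fin d) → EuclideanSpace ℝ (Fin d)) : Prop :=
  LocallyIntegrableOn v Ω volume ∧ LocallyIntegrableOn g Ω volume ∧
    ∀ φ : EuclideanSpace ℝ (Fin d) → ℝ, ContDiff ℝ ∞ φ → HasCompactSupport φ → tsupport φ ⊆ Ω →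
      ∫ x in Ω, v x • gradient φ x = - ∫ x in Ω, φ x • g x

/-- `v ∈ H¹(Ω)`. -/
def MemH1 {d : ℕ} (Ω : Set (EuclideanSpace ℝ (Fin d)))
    (v : EuclideanSpace ℝ (Fin d) → ℝ) : Prop :=
  MemLp v 2 (volume.restrict Ω) ∧
    ∃ g, HasWeakGradient Ω v g ∧ MemLp g 2 (volume.restrict Ω)

/-- The function `t` is the trace of `v : Ω → ℝ` on `Γ ⊆ ∂Ω`: for almost every `x ∈ Γ` with respect
to the `(d-1)`-dimensional Hausdorff measure, the mean of `|v - t(x)|` over `Ω ∩ B(x, ρ)` tends to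
zero as `ρ → 0`. For functions in `H¹(Ω)` or `BV(Ω)` (such as characteristic functions of Lipschitz
domains) on a bounded Lipschitz domain this characterizes the usual trace. -/
def HasTraceOn {d : ℕ} (Ω Γ : Set (EuclideanSpace ℝ (Fin d)))
    (v t : EuclideanSpace ℝ (Fin d) → ℝ) : Prop :=
  ∀ᵐ x ∂(Measure.hausdorffMeasure ((d : ℝ) - 1) : Measure (EuclideanSpace ℝ (Fin d))), x ∈ Γ →
    Tendsto (fun ρ : ℝ => ⨍⁻ y in Metric.ball x ρ ∩ Ω, ‖v y - t x‖ₑ ∂volume) (𝓝[>] 0) (𝓝 0)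

/-! ### Admissible methods -/

/-- `U_δ = {x ∈ Ω : dist (x, ∂A ∩ Ω) < δ}` (empty when `∂A ∩ Ω` is empty). -/
def interfaceNhd {d : ℕ} (Ω A : Set (EuclideanSpace ℝ (Fin d))) (δ : ℝ) :
    Set (EuclideanSpace ℝ (Fin d)) :=
  Ω ∩ Metric.thickening δ (frontier A ∩ Ω)

/-- `f` is a pointwise extension of the characteristic function `χ_A` to all of `closure Ω`: at
each point it takes one of the values which `χ_A` takes, off `∂A`, arbitrarily close to this point.
In particular `f = χ_A` on `closure Ω \ ∂A`, whereas either value may be allowed on `∂A`. -/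
def IsIndicatorExtension {d : ℕ} (Ω A : Set (EuclideanSpace ℝ (Fin d)))
    (f : EuclideanSpace ℝ (Fin d) → ℝ) : Prop :=
  ∀ x ∈ closure Ω,
    (f x = 1 ∧ x ∈ closure A) ∨ (f x = 0 ∧ x ∈ closure (Ω \ closure A))

/-- The four conditions on the approximations `vδ` (`δ` in the index set `H`) of the
characteristic function `χ_A`. -/
structure AdmissibleConditions {d : ℕ} (Ω : Set (EuclideanSpace ℝ (Fin d))) (H : Set ℝ)
    (A : Set (EuclideanSpace ℝ (Fin d))) (v : ℝ → EuclideanSpace ℝ (Fin d) → ℝ) : Prop where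
  /-- convergence in `L²(Ω)` -/
  tendsto_L2 : Tendsto
    (fun δ => eLpNorm (fun x => v δ x - A.indicator (fun _ => (1 : ℝ)) x) 2 (volume.restrict Ω))
    (𝓝[H] 0) (𝓝 0)
  /-- the gradient is bounded, and its support lies in `closure U_δ` -/
  gradient_support : ∀ δ ∈ H, ∃ g, HasWeakGradient Ω (v δ) g ∧ MemLp g ∞ (volume.restrict Ω) ∧
    ∀ᵐ x ∂(volume.restrict (Ω \ closure (interfaceNhd Ω A δ))), g x = 0
  /-- `δ ‖∇ v_δ‖_{L^∞(Ω)} ≤ C` for all sufficiently small `δ` -/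
  gradient_bound : ∃ C : ℝ, ∀ᶠ δ in 𝓝[H] 0, ∀ g, HasWeakGradient Ω (v δ) g →
    ENNReal.ofReal δ * eLpNorm g ∞ (volume.restrict Ω) ≤ ENNReal.ofReal C
  /-- the traces of `χ_A` and of `v_δ` agree on the boundary, away from `∂U_δ` -/
  trace_eq : ∀ δ ∈ H, ∀ Γ ⊆ frontier Ω \ frontier (interfaceNhd Ω A δ),
    0 < (Measure.hausdorffMeasure ((d : ℝ) - 1) : Measure (EuclideanSpace ℝ (Fin d))) Γ →
    ∃ t, HasTraceOn Ω Γ (A.indicator fun _ => (1 : ℝ)) t ∧ HasTraceOn Ω Γ (v δ) t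

/-- An admissible method: linear maps `I δ` (`δ` in the index set `H ⊆ (0, ∞)`), with values in
spaces `V δ ⊆ H¹(Ω)`, such that for every Lipschitz domain `A ⊆ Ω` and every pointwise extension of
`χ_A` to `closure Ω` the four conditions hold. Since point values matter for interpolation, `I δ`
acts on functions and not on classes of functions. -/
structure IsAdmissibleMethod {d : ℕ} (Ω : Set (EuclideanSpace ℝ (Fin d))) (H : Set ℝ)
    (V : ℝ → Submodule ℝ (EuclideanSpace ℝ (Fin d) → ℝ))
    (I : ℝ → (EuclideanSpace ℝ (Fin d) → ℝ) → (EuclideanSpace ℝ (Fin d) → ℝ)) : Prop where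
  index_pos : H ⊆ Ioi 0
  conforming : ∀ δ ∈ H, ∀ v ∈ V δ, MemH1 Ω v
  mem_space : ∀ δ ∈ H, ∀ f, I δ f ∈ V δ
  linear : ∀ δ ∈ H, IsLinearMap ℝ (I δ)
  conditions : ∀ A, IsLipschitzDomain A → A ⊆ Ω → ∀ f, IsIndicatorExtension Ω A f →
    AdmissibleConditions Ω H A (fun δ => I δ f)

/-! ### Piecewise constant media -/

/-- A piecewise constant medium `u = ∑ ω_m χ_{Ω^m} + ∑ α_k χ_{A^k}` in `Ω`. -/
structure PiecewiseConstantMedium {d : ℕ} (Ω : Set (EuclideanSpace ℝ (Fin d))) where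
  /-- number of background subdomains -/
  M : ℕ
  /-- number of inclusions -/
  K : ℕ
  /-- background values -/
  bgVal : Fin M → ℝ
  /-- background subdomains `Ω^m` -/
  bg : Fin M → Set (EuclideanSpace ℝ (Fin d))
  /-- values of the inclusions -/
  inclVal : Fin K → ℝ
  /-- inclusions `A^k` -/
  incl : Fin K → Set (EuclideanSpace ℝ (Fin d))
  inclVal_ne_zero : ∀ k, inclVal k ≠ 0
  bg_lipschitz : ∀ m, IsLipschitzDomain (bg m)
  bg_disjoint : ∀ m n, m ≠ n → Disjoint (bg m) (bg n)
  bg_cover : closure Ω = ⋃ m, closure (bg m)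
  bg_extend : ∃ W : Fin M → Set (EuclideanSpace ℝ (Fin d)),
    (∀ m, IsLipschitzDomain (W m) ∧ Bornology.IsBounded (W m)) ∧
    (∀ m n, m ≠ n → Disjoint (W m) (W n)) ∧
    ∀ m, bg m = Ω ∩ W m ∧ (frontier Ω ∩ W m).Nonempty
  incl_lipschitz : ∀ k, IsLipschitzDomain (incl k)
  incl_frontier_disjoint : ∀ j k, j ≠ k → Disjoint (frontier (incl j)) (frontier (incl k))
  incl_frontier_connected : ∀ k, IsConnected (frontier (incl k))
  incl_compactly_contained : ∀ k, ∃ m, closure (incl k) ⊆ bg m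

namespace PiecewiseConstantMedium

/-- The linear combination of functions `b m` and `a k` with the coefficients of the medium. -/
def combine {d : ℕ} {Ω : Set (EuclideanSpace ℝ (Fin d))} (u : PiecewiseConstantMedium Ω)
    (b : Fin u.M → EuclideanSpace ℝ (Fin d) → ℝ) (a : Fin u.K → EuclideanSpace ℝ (Fin d) → ℝ) :
    EuclideanSpace ℝ (Fin d) → ℝ :=
  ∑ m, u.bgVal m • b m + ∑ k, u.inclVal k • a k

/-- `u(x) = ∑ ω_m χ_{Ω^m}(x) + ∑ α_k χ_{A^k}(x)`. -/
def val {d : ℕ} {Ω : Set (EuclideanSpace ℝ (Fin d))} (u : PiecewiseConstantMedium Ω) :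
    EuclideanSpace ℝ (Fin d) → ℝ :=
  u.combine (fun m => (u.bg m).indicator 1) (fun k => (u.incl k).indicator 1)

/-- The union of all interfaces `∂Ω^m` and `∂A^k`. -/
def interfaces {d : ℕ} {Ω : Set (EuclideanSpace ℝ (Fin d))} (u : PiecewiseConstantMedium Ω) :
    Set (EuclideanSpace ℝ (Fin d)) :=
  (⋃ m, frontier (u.bg m)) ∪ ⋃ k, frontier (u.incl k)

/-- First kind of extension of `u` to `closure Ω`: at each point `f` takes the value of `u` in a
neighbouring domain, i.e. a value that the (off the interfaces locally constant) function `u`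
takes, off the interfaces, arbitrarily close to this point. In particular `f = u` off the
interfaces. -/
def IsNeighbourExtension {d : ℕ} {Ω : Set (EuclideanSpace ℝ (Fin d))}
    (u : PiecewiseConstantMedium Ω) (f : EuclideanSpace ℝ (Fin d) → ℝ) : Prop :=
  ∀ x ∈ closure Ω, x ∈ closure {y | y ∈ Ω \ u.interfaces ∧ u.val y = f x}

/-- Second kind of extension of `u` to `closure Ω`: replace `Ω^m` and `A^k` by their closures. -/
def IsClosureExtension {d : ℕ} {Ω : Set (EuclideanSpace ℝ (Fin d))}
    (u : PiecewiseConstantMedium Ω) (f : EuclideanSpace ℝ (Fin d) → ℝ) : Prop :=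
  ∀ x ∈ closure Ω, f x = u.combine (fun m => (closure (u.bg m)).indicator 1)
    (fun k => (closure (u.incl k)).indicator 1) x

/-- `uδ` is an admissible approximation of `u`: it is obtained from `u` by an admissible method
with values in the spaces `V δ`, applied to pointwise extensions of the characteristic functions
which `u` consists of. -/
def IsAdmissibleApproximation {d : ℕ} {Ω : Set (EuclideanSpace ℝ (Fin d))}
    (u : PiecewiseConstantMedium Ω) (H : Set ℝ)
    (V : ℝ → Submodule ℝ (EuclideanSpace ℝ (Fin d) → ℝ))
    (uδ : ℝ → EuclideanSpace ℝ (Fin d) → ℝ) : Prop :=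
  ∃ I : ℝ → (EuclideanSpace ℝ (Fin d) → ℝ) → (EuclideanSpace ℝ (Fin d) → ℝ),
    IsAdmissibleMethod Ω H V I ∧
    ∃ (b : Fin u.M → EuclideanSpace ℝ (Fin d) → ℝ) (a : Fin u.K → EuclideanSpace ℝ (Fin d) → ℝ),
    (∀ m, IsIndicatorExtension Ω (u.bg m) (b m)) ∧
    (∀ k, IsIndicatorExtension Ω (u.incl k) (a k)) ∧
    ∀ δ ∈ H, uδ δ = u.combine (fun m => I δ (b m)) (fun k => I δ (a k))

end PiecewiseConstantMedium

/-! ### Simplicial meshes and Lagrange finite elements -/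

/-- The elements of a mesh, given by their vertex sets: the faces with `d + 1` vertices. -/
def meshElements {d : ℕ} (T : Geometry.SimplicialComplex ℝ (EuclideanSpace ℝ (Fin d))) :
    Set (Finset (EuclideanSpace ℝ (Fin d))) :=
  {s | s ∈ T.faces ∧ s.card = d + 1}

/-- The closed simplex with vertex set `s`. -/
def simplexHull {d : ℕ} (s : Finset (EuclideanSpace ℝ (Fin d))) :
    Set (EuclideanSpace ℝ (Fin d)) :=
  convexHull ℝ (s : Set (EuclideanSpace ℝ (Fin d)))

/-- `T` is a conforming simplicial mesh of `Ω`: finitely many nondegenerate `d`-simplices (together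
with their faces), which cover `closure Ω` and of which any two intersect in a common face (the
latter is part of Mathlib's notion of a simplicial complex). -/
def IsSimplicialMesh {d : ℕ} (Ω : Set (EuclideanSpace ℝ (Fin d)))
    (T : Geometry.SimplicialComplex ℝ (EuclideanSpace ℝ (Fin d))) : Prop :=
  T.faces.Finite ∧ (∀ s ∈ T.faces, ∃ t ∈ meshElements T, s ⊆ t) ∧
    ⋃ s ∈ meshElements T, simplexHull s = closure Ω

/-- The mesh size of `T` is `h`: the largest diameter of an element. -/
def HasMeshSize {d : ℕ} (T : Geometry.SimplicialComplex ℝ (EuclideanSpace ℝ (Fin d)))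
    (h : ℝ) : Prop :=
  IsGreatest {δ | ∃ s ∈ meshElements T, δ = Metric.diam (simplexHull s)} h

/-- The largest diameter of a ball contained in the simplex with vertex set `s`. -/
def inballDiam {d : ℕ} (s : Finset (EuclideanSpace ℝ (Fin d))) : ℝ :=
  2 * sSup {ρ : ℝ | 0 ≤ ρ ∧ ∃ c, Metric.closedBall c ρ ⊆ simplexHull s}

/-- The family of meshes `T h`, `h ∈ H`, is regular: the ratio between the diameter of an element
and the diameter of its largest inscribed ball is bounded uniformly in the element and in `h`. -/
def IsRegularMeshFamily {d : ℕ} (H : Set ℝ)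
    (T : ℝ → Geometry.SimplicialComplex ℝ (EuclideanSpace ℝ (Fin d))) : Prop :=
  ∃ σ : ℝ, ∀ h ∈ H, ∀ s ∈ meshElements (T h),
    Metric.diam (simplexHull s) ≤ σ * inballDiam s

/-- The family of meshes `T h` of mesh size `h`, `h ∈ H`, is quasi-uniform: all elements of `T h`
have diameter at least `τ h`, with `τ > 0` independent of `h`. -/
def IsQuasiUniformMeshFamily {d : ℕ} (H : Set ℝ)
    (T : ℝ → Geometry.SimplicialComplex ℝ (EuclideanSpace ℝ (Fin d))) : Prop :=
  ∃ τ : ℝ, 0 < τ ∧ ∀ h ∈ H, ∀ s ∈ meshElements (T h), τ * h ≤ Metric.diam (simplexHull s)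

/-- On the set `S`, the function `v` coincides with a polynomial of total degree at most `r`. -/
def IsPolynomialOn {d : ℕ} (r : ℕ) (S : Set (EuclideanSpace ℝ (Fin d)))
    (v : EuclideanSpace ℝ (Fin d) → ℝ) : Prop :=
  ∃ p : MvPolynomial (Fin d) ℝ, p.totalDegree ≤ r ∧
    ∀ x ∈ S, v x = MvPolynomial.eval (fun i => x i) p

/-- The `H¹`-conforming `P^r` finite element space on the mesh `T` of `Ω`: the functions on
`closure Ω` (extended by zero) which are continuous and, on each element, a polynomial of degree at
most `r`. -/
def feSpace {d : ℕ} (Ω : Set (EuclideanSpace ℝ (Fin d)))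
    (T : Geometry.SimplicialComplex ℝ (EuclideanSpace ℝ (Fin d))) (r : ℕ) :
    Submodule ℝ (EuclideanSpace ℝ (Fin d) → ℝ) where
  carrier := {v | ContinuousOn v (closure Ω) ∧ (∀ x ∉ closure Ω, v x = 0) ∧
    ∀ s ∈ meshElements T, IsPolynomialOn r (simplexHull s) v}
  zero_mem' := ⟨continuousOn_const, fun _ _ => rfl, fun _ _ => ⟨0, by simp, by simp⟩⟩
  add_mem' := by
    rintro v w ⟨hv, hv0, hvp⟩ ⟨hw, hw0, hwp⟩
    refine ⟨hv.add hw, fun x hx => by simp [hv0 x hx, hw0 x hx], fun s hs => ?_⟩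
    obtain ⟨p, hp, hpv⟩ := hvp s hs
    obtain ⟨q, hq, hqw⟩ := hwp s hs
    exact ⟨p + q, (MvPolynomial.totalDegree_add p q).trans (max_le hp hq),
      fun x hx => by simp [hpv x hx, hqw x hx]⟩
  smul_mem' := by
    rintro c v ⟨hv, hv0, hvp⟩
    refine ⟨hv.const_smul c, fun x hx => by simp [hv0 x hx], fun s hs => ?_⟩
    obtain ⟨p, hp, hpv⟩ := hvp s hs
    exact ⟨c • p, (MvPolynomial.totalDegree_smul_le c p).trans hp,
      fun x hx => by simp [hpv x hx, MvPolynomial.smul_eval]⟩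

/-- The `P^r` Lagrange nodes of the simplex with vertex set `s`: the points whose barycentric
coordinates are integer multiples of `1 / r`. -/
def lagrangeNodes {d : ℕ} (r : ℕ) (s : Finset (EuclideanSpace ℝ (Fin d))) :
    Set (EuclideanSpace ℝ (Fin d)) :=
  {x | ∃ a : EuclideanSpace ℝ (Fin d) → ℕ, ∑ p ∈ s, a p = r ∧
    x = ∑ p ∈ s, ((a p : ℝ) / (r : ℝ)) • p}

/-- `v` is the `P^r` finite element interpolant of `w`: it belongs to the finite element space and
has the same values as `w` at all Lagrange nodes of all elements. -/
def IsFEInterpolant {d : ℕ} (Ω : Set (EuclideanSpace ℝ (Fin d)))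
    (T : Geometry.SimplicialComplex ℝ (EuclideanSpace ℝ (Fin d))) (r : ℕ)
    (w v : EuclideanSpace ℝ (Fin d) → ℝ) : Prop :=
  v ∈ feSpace Ω T r ∧ ∀ s ∈ meshElements T, ∀ x ∈ lagrangeNodes r s, v x = w x

end

/-!
Why the theorem is true. In barycentric coordinates `l` of a simplex, the Lagrange basis function of
the node `a / r` is `∏ nodeFactor r (a p) (l p)`. It vanishes on the faces which do not contain the
node, so the elementwise interpolants fit together continuously. They are unique because a polynomial
of degree at most `r` is a form of degree `r` in `l`, and the linear map from the coefficients of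
such a form to its nodal values is onto, hence bijective (`isHomogeneous_eval_eq_zero`).

A continuous, elementwise Lipschitz function is locally Lipschitz in `Ω`, so by Rademacher's theorem
its pointwise gradient is bounded and is its weak gradient (`hasWeakGradient_gradient`). This gives
`V_h ⊆ H¹(Ω)`. The values and the Lipschitz constant of an interpolant on an element are controlled
by the nodal values and by the gradients of the barycentric coordinates (`exists_localInterp_bound`),
which are at most the reciprocal of the diameter of an inscribed ball, hence of order `1 / h` on a
regular and quasi-uniform family of meshes.

The geometric heart is `IsIndicatorExtension.eq_const_of_disjoint`: on an element which stays away
from `closure (∂A ∩ Ω)`, all nodal values of an extension of `χ_A` are equal to the constant value of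
`χ_A` in the interior of the element. The delicate nodes are those on `∂Ω`. There, the local
connectedness of the Lipschitz domain `Ω` up to its boundary shows that where both `A` and `Ω \ A`
come close, so does the interface (`IsLipschitzDomain.mem_closure_frontier_inter`). All other elements
are contained in `closure U_h`. Therefore the interpolant agrees with `χ_A` almost everywhere off
`closure U_h`, which yields the conditions on the support of the gradient and on the traces, and, as
the boundary of a Lipschitz domain is a null set, the convergence in `L²(Ω)`.

For media it remains to write both extensions of `u` as combinations of extensions of the
characteristic functions (`PiecewiseConstantMedium.exists_extensions`).
-/

/-! ### Lagrange basis functions in barycentric coordinates -/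

/-- The univariate polynomial `t ↦ ∏_{j < n} (r t - j) / (n - j)`, which vanishes at the points
`j / r` with `j < n` and equals `1` at `n / r`. -/
noncomputable def nodeFactor (r n : ℕ) (t : ℝ) : ℝ :=
  ∏ j ∈ Finset.range n, ((r : ℝ) * t - j) / ((n : ℝ) - j)

@[simp] lemma nodeFactor_zero_left (r : ℕ) (t : ℝ) : nodeFactor r 0 t = 1 := by
  simp [nodeFactor]

lemma nodeFactor_zero_right (r : ℕ) {n : ℕ} (hn : n ≠ 0) : nodeFactor r n 0 = 0 := by
  refine Finset.prod_eq_zero (i := 0) (Finset.mem_range.2 (Nat.pos_of_ne_zero hn)) ?_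
  simp

lemma nodeFactor_div_self {r : ℕ} (hr : 1 ≤ r) (n : ℕ) : nodeFactor r n ((n : ℝ) / r) = 1 := by
  have hr' : (r : ℝ) ≠ 0 := by positivity
  refine Finset.prod_eq_one fun j hj => ?_
  have hj' : (j : ℝ) < n := by exact_mod_cast Finset.mem_range.1 hj
  rw [mul_div_cancel₀ _ hr', div_self (by linarith)]

lemma nodeFactor_div_of_lt {r : ℕ} (hr : 1 ≤ r) {m n : ℕ} (h : m < n) :
    nodeFactor r n ((m : ℝ) / r) = 0 := by
  have hr' : (r : ℝ) ≠ 0 := by positivity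
  refine Finset.prod_eq_zero (Finset.mem_range.2 h) ?_
  rw [mul_div_cancel₀ _ hr', sub_self, zero_div]

/-- If two multi-indices on `s` have the same length and are different, then some entry of the
second is strictly smaller than the corresponding entry of the first. -/
lemma exists_lt_of_sum_eq {ι : Type*} {s : Finset ι} {a b : ι → ℕ}
    (hab : ∑ i ∈ s, a i = ∑ i ∈ s, b i) (hne : ∃ i ∈ s, a i ≠ b i) : ∃ i ∈ s, b i < a i := by
  by_contra! h
  obtain ⟨i, hi, hi'⟩ := hne
  exact hi' ((Finset.sum_eq_sum_iff_of_le h).1 hab i hi)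

/-- The product of the univariate factors is the Lagrange basis function of the node with
barycentric coordinates `a / r`. -/
lemma prod_nodeFactor_div {ι : Type*} {r : ℕ} (hr : 1 ≤ r) {s : Finset ι} {a b : ι → ℕ}
    (hab : ∑ i ∈ s, a i = ∑ i ∈ s, b i) [Decidable (∀ i ∈ s, a i = b i)] :
    ∏ i ∈ s, nodeFactor r (a i) ((b i : ℝ) / r) = if ∀ i ∈ s, a i = b i then 1 else 0 := by
  split_ifs with h
  · exact Finset.prod_eq_one fun i hi => by rw [h i hi, nodeFactor_div_self hr]
  · push Not at h
    obtain ⟨i, hi, hlt⟩ := exists_lt_of_sum_eq hab h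
    exact Finset.prod_eq_zero hi (nodeFactor_div_of_lt hr hlt)

/-! ### Unisolvence -/

section Unisolvence

open MvPolynomial

variable {σ : Type*} [Fintype σ]

/-- A form of degree `r` which has the value `∏ i, nodeFactor r (a i) (l i)` at each `l` with
`∑ i, l i = 1`: the homogenization of the Lagrange basis function. -/
noncomputable def nodeForm (r : ℕ) (a : σ →₀ ℕ) : MvPolynomial σ ℝ :=
  ∏ i, ∏ j ∈ Finset.range (a i),
    C (((a i : ℝ) - j)⁻¹) * (C (r : ℝ) * X i - C (j : ℝ) * ∑ k, X k)

lemma nodeForm_isHomogeneous (r : ℕ) (a : σ →₀ ℕ) : (nodeForm r a).IsHomogeneous (∑ i, a i) := by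
  refine IsHomogeneous.prod _ _ _ fun i _ => ?_
  have h := IsHomogeneous.prod (Finset.range (a i))
    (fun j : ℕ => C (((a i : ℝ) - j)⁻¹) * (C (r : ℝ) * X i - C (j : ℝ) * ∑ k : σ, X k)) (fun _ => 1)
    fun j _ => by
      have h1 : (C (r : ℝ) * X i : MvPolynomial σ ℝ).IsHomogeneous (0 + 1) :=
        (isHomogeneous_C _ _).mul (isHomogeneous_X _ _)
      have h2 : (C (j : ℝ) * ∑ k : σ, X k : MvPolynomial σ ℝ).IsHomogeneous (0 + 1) :=
        (isHomogeneous_C _ _).mul (IsHomogeneous.sum _ _ _ fun k _ => isHomogeneous_X _ _)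
      simpa using (isHomogeneous_C σ (((a i : ℝ) - j)⁻¹)).mul (h1.sub h2)
  simpa using h

lemma eval_nodeForm (r : ℕ) (a : σ →₀ ℕ) {l : σ → ℝ} (hl : ∑ i, l i = 1) :
    eval l (nodeForm r a) = ∏ i, nodeFactor r (a i) (l i) := by
  simp only [nodeForm, map_prod, nodeFactor]
  refine Finset.prod_congr rfl fun i _ => Finset.prod_congr rfl fun j _ => ?_
  simp [hl, div_eq_inv_mul]

lemma eval_eq_sum_finsuppAntidiag [DecidableEq σ] {r : ℕ} {P : MvPolynomial σ ℝ} (hP : P.IsHomogeneous r)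
    (l : σ → ℝ) :
    eval l P = ∑ a ∈ Finset.finsuppAntidiag Finset.univ r, coeff a P * ∏ i, l i ^ a i := by
  rw [eval_eq']
  refine Finset.sum_subset (fun a ha => ?_) fun a _ ha => by simp [notMem_support_iff.1 ha]
  have := hP (mem_support_iff.1 ha)
  simp only [Finset.mem_finsuppAntidiag, Finset.subset_univ, and_true]
  rw [← this, Finsupp.weight_apply, Finsupp.sum_fintype] <;> simp

/-- A form of degree `r` is determined by its values at the nodes `a / r`, `|a| = r`: evaluation at
the nodes maps the coefficients linearly to as many values, and it is onto because of the Lagrange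
basis functions. -/
theorem isHomogeneous_eval_eq_zero [DecidableEq σ] {r : ℕ} (hr : 1 ≤ r) {P : MvPolynomial σ ℝ}
    (hP : P.IsHomogeneous r)
    (h0 : ∀ a ∈ Finset.finsuppAntidiag (Finset.univ : Finset σ) r,
      eval (fun i => (a i : ℝ) / r) P = 0) (l : σ → ℝ) : eval l P = 0 := by
  set N := Finset.finsuppAntidiag (Finset.univ : Finset σ) r with hN
  have hsum : ∀ a ∈ N, ∑ i, a i = r := fun a ha => (Finset.mem_finsuppAntidiag.1 ha).1
  have hr' : (r : ℝ) ≠ 0 := by positivity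
  let Ψ : (N → ℝ) →ₗ[ℝ] (N → ℝ) := Matrix.mulVecLin
    (Matrix.of fun b a : N => ∏ i, ((b.1 i : ℝ) / r) ^ a.1 i)
  have hΨ : ∀ (Q : MvPolynomial σ ℝ), Q.IsHomogeneous r →
      Ψ (fun a => coeff a.1 Q) = fun b : N => eval (fun i => (b.1 i : ℝ) / r) Q := by
    intro Q hQ
    ext b
    simp only [Ψ, Matrix.mulVecLin_apply, Matrix.mulVec, dotProduct, Matrix.of_apply]
    rw [eval_eq_sum_finsuppAntidiag hQ, ← hN, ← Finset.sum_coe_sort N]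
    exact Finset.sum_congr rfl fun a _ => mul_comm _ _
  have hsurj : Function.Surjective Ψ := by
    intro g
    let Q : MvPolynomial σ ℝ := ∑ a : N, C (g a) * nodeForm r a.1
    have hQ : Q.IsHomogeneous r := by
      refine IsHomogeneous.sum _ _ _ fun a _ => ?_
      have := (isHomogeneous_C σ (g a)).mul (nodeForm_isHomogeneous r a.1)
      rwa [hsum _ a.2, zero_add] at this
    refine ⟨fun a => coeff a.1 Q, ?_⟩
    rw [hΨ Q hQ]
    ext b
    have hb : ∑ i, (b.1 i : ℝ) / r = 1 := by
      rw [← Finset.sum_div, ← Nat.cast_sum, hsum _ b.2, div_self hr']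
    simp only [Q, map_sum, map_mul, eval_C, eval_nodeForm r _ hb]
    rw [Finset.sum_eq_single b]
    · rw [prod_nodeFactor_div hr rfl]; simp
    · intro a _ hab
      rw [prod_nodeFactor_div hr (by rw [hsum _ a.2, hsum _ b.2]), if_neg, mul_zero]
      exact fun h => hab (Subtype.ext (Finsupp.ext fun i => h i (Finset.mem_univ i)))
    · simp
  have hinj : Function.Injective Ψ := LinearMap.injective_iff_surjective.2 hsurj
  have hc : (fun a : N => coeff a.1 P) = 0 := by
    apply hinj
    rw [hΨ P hP, map_zero]
    ext b
    exact h0 _ b.2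
  rw [eval_eq_sum_finsuppAntidiag hP]
  exact Finset.sum_eq_zero fun a ha => by rw [show coeff a P = 0 from congrFun hc ⟨a, ha⟩, zero_mul]

/-- A polynomial of degree at most `r` in the point with barycentric coordinates `l` with respect to
the points `b i` is a form of degree `r` in `l`. -/
lemma exists_isHomogeneous_eval_eq {n r : ℕ} (b : σ → Fin n → ℝ) {p : MvPolynomial (Fin n) ℝ}
    (hp : p.totalDegree ≤ r) :
    ∃ P : MvPolynomial σ ℝ, P.IsHomogeneous r ∧
      ∀ l : σ → ℝ, ∑ i, l i = 1 → eval (fun k => ∑ i, l i * b i k) p = eval l P := by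
  refine ⟨∑ d ∈ p.support, C (coeff d p) * ((∏ k, (∑ i, X i * C (b i k)) ^ d k) *
    (∑ i, X i) ^ (r - ∑ k, d k)), ?_, fun l hl => ?_⟩
  · refine IsHomogeneous.sum _ _ _ fun d hd => ?_
    have hdr : ∑ k, d k ≤ r := by
      refine le_trans ?_ hp
      have := le_totalDegree hd
      rwa [Finsupp.sum_fintype _ _ (by simp)] at this
    have h1 : (∏ k, (∑ i : σ, X i * C (b i k) : MvPolynomial σ ℝ) ^ d k).IsHomogeneous
        (∑ k, d k) := by
      refine IsHomogeneous.prod _ _ _ fun k _ => ?_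
      have : (∑ i : σ, X i * C (b i k) : MvPolynomial σ ℝ).IsHomogeneous 1 :=
        IsHomogeneous.sum _ _ _ fun i _ => by
          simpa using (isHomogeneous_X ℝ i).mul (isHomogeneous_C σ (b i k))
      simpa using this.pow (d k)
    have h2 : ((∑ i : σ, X i : MvPolynomial σ ℝ) ^ (r - ∑ k, d k)).IsHomogeneous
        (r - ∑ k, d k) := by
      have : (∑ i : σ, X i : MvPolynomial σ ℝ).IsHomogeneous 1 :=
        IsHomogeneous.sum _ _ _ fun i _ => isHomogeneous_X ℝ i
      simpa using this.pow (r - ∑ k, d k)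
    have := (isHomogeneous_C σ (coeff d p)).mul (h1.mul h2)
    rwa [zero_add, Nat.add_sub_cancel' hdr] at this
  · rw [eval_eq']
    simp [hl]

end Unisolvence

/-! ### Barycentric coordinates of a simplex -/

section Simplex

variable {d : ℕ}

/-- The points of `s` are the vertices of a nondegenerate `d`-simplex. -/
def IsNondegenerateSimplex (s : Finset (EuclideanSpace ℝ (Fin d))) : Prop :=
  AffineIndependent ℝ ((↑) : s → EuclideanSpace ℝ (Fin d)) ∧ s.card = d + 1

/-- The vertices of a nondegenerate simplex as an affine basis. -/
noncomputable def IsNondegenerateSimplex.affineBasis {s : Finset (EuclideanSpace ℝ (Fin d))}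
    (hs : IsNondegenerateSimplex s) : AffineBasis s ℝ (EuclideanSpace ℝ (Fin d)) where
  toFun := (↑)
  ind' := hs.1
  tot' := by
    rw [hs.1.affineSpan_eq_top_iff_card_eq_finrank_add_one]
    simp [hs.2]

open Classical in
/-- The barycentric coordinate with respect to the vertex `p` of the simplex with vertex set `s`. It
is an affine function on the whole space; by convention it is zero if `p` is not a vertex. -/
noncomputable def baryCoord (s : Finset (EuclideanSpace ℝ (Fin d)))
    (p : EuclideanSpace ℝ (Fin d)) : EuclideanSpace ℝ (Fin d) →ᵃ[ℝ] ℝ :=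
  if h : IsNondegenerateSimplex s ∧ p ∈ s then h.1.affineBasis.coord ⟨p, h.2⟩ else 0

variable {s t : Finset (EuclideanSpace ℝ (Fin d))}

lemma baryCoord_of_mem (hs : IsNondegenerateSimplex s) (p : s) :
    baryCoord s p = hs.affineBasis.coord p := by
  simp [baryCoord, hs]

lemma baryCoord_of_notMem {p : EuclideanSpace ℝ (Fin d)} (hp : p ∉ s)
    (x : EuclideanSpace ℝ (Fin d)) : baryCoord s p x = 0 := by
  simp [baryCoord, hp]

lemma sum_baryCoord (hs : IsNondegenerateSimplex s) (x : EuclideanSpace ℝ (Fin d)) :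
    ∑ p ∈ s, baryCoord s p x = 1 := by
  rw [← Finset.sum_coe_sort s]
  simp_rw [baryCoord_of_mem hs]
  exact hs.affineBasis.sum_coord_apply_eq_one x

lemma sum_baryCoord_smul (hs : IsNondegenerateSimplex s) (x : EuclideanSpace ℝ (Fin d)) :
    ∑ p ∈ s, baryCoord s p x • p = x := by
  rw [← Finset.sum_coe_sort s]
  simp_rw [baryCoord_of_mem hs]
  exact hs.affineBasis.linear_combination_coord_eq_self x

lemma baryCoord_sum_smul (hs : IsNondegenerateSimplex s) {w : EuclideanSpace ℝ (Fin d) → ℝ}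
    (hw : ∑ p ∈ s, w p = 1) {p : EuclideanSpace ℝ (Fin d)} (hp : p ∈ s) :
    baryCoord s p (∑ q ∈ s, w q • q) = w p := by
  have h := baryCoord_of_mem hs ⟨p, hp⟩
  simp only at h
  rw [h]
  have hw' : (Finset.univ : Finset s).sum (fun q => w q) = 1 := by
    rw [Finset.sum_coe_sort s w, hw]
  have := hs.affineBasis.coord_apply_combination_of_mem (Finset.mem_univ ⟨p, hp⟩) hw'
  rw [Finset.affineCombination_eq_linear_combination _ _ _ hw'] at this
  rw [← Finset.sum_coe_sort s fun q => w q • q]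
  exact this

lemma range_affineBasis (hs : IsNondegenerateSimplex s) :
    range hs.affineBasis = (s : Set (EuclideanSpace ℝ (Fin d))) := by
  ext x
  simp [IsNondegenerateSimplex.affineBasis, DFunLike.coe]

lemma mem_simplexHull_iff (hs : IsNondegenerateSimplex s) {x : EuclideanSpace ℝ (Fin d)} :
    x ∈ simplexHull s ↔ ∀ p ∈ s, 0 ≤ baryCoord s p x := by
  rw [simplexHull, ← range_affineBasis hs, hs.affineBasis.convexHull_eq_nonneg_coord]
  simp only [mem_ofPred_eq, ← baryCoord_of_mem hs, Subtype.forall]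

lemma baryCoord_mem_Icc (hs : IsNondegenerateSimplex s) {x : EuclideanSpace ℝ (Fin d)}
    (hx : x ∈ simplexHull s) {p : EuclideanSpace ℝ (Fin d)} (hp : p ∈ s) :
    baryCoord s p x ∈ Icc (0 : ℝ) 1 := by
  have h := (mem_simplexHull_iff hs).1 hx
  refine ⟨h p hp, ?_⟩
  rw [← sum_baryCoord hs x]
  exact Finset.single_le_sum h hp

lemma nonempty_interior_simplexHull (hs : IsNondegenerateSimplex s) :
    (interior (simplexHull s)).Nonempty := by
  rw [simplexHull, interior_convexHull_nonempty_iff_affineSpan_eq_top, ← range_affineBasis hs]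
  exact hs.affineBasis.tot

lemma convex_simplexHull (s : Finset (EuclideanSpace ℝ (Fin d))) : Convex ℝ (simplexHull s) :=
  convex_convexHull ℝ _

lemma isCompact_simplexHull (s : Finset (EuclideanSpace ℝ (Fin d))) : IsCompact (simplexHull s) :=
  s.finite_toSet.isCompact_convexHull ℝ

lemma closure_interior_simplexHull (hs : IsNondegenerateSimplex s) :
    closure (interior (simplexHull s)) = simplexHull s := by
  rw [(convex_simplexHull s).closure_interior_eq_closure_of_nonempty_interior
    (nonempty_interior_simplexHull hs), (isCompact_simplexHull s).isClosed.closure_eq]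

/-- The barycentric coordinates with respect to two simplices agree on the common face. -/
lemma baryCoord_eq_of_mem_inter (hs : IsNondegenerateSimplex s) (ht : IsNondegenerateSimplex t)
    {x : EuclideanSpace ℝ (Fin d)}
    (hx : x ∈ convexHull ℝ ((s : Set (EuclideanSpace ℝ (Fin d))) ∩ t)) :
    (∀ p, baryCoord s p x = baryCoord t p x) ∧ ∀ p, p ∉ t → baryCoord s p x = 0 := by
  classical
  rw [← Finset.coe_inter, Finset.mem_convexHull'] at hx
  obtain ⟨w, -, hw1, rfl⟩ := hx
  -- extended by zero, the weights of `x` are its barycentric coordinates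
  have key : ∀ {u : Finset (EuclideanSpace ℝ (Fin d))}, IsNondegenerateSimplex u → s ∩ t ⊆ u →
      ∀ p, baryCoord u p (∑ y ∈ s ∩ t, w y • y) = if p ∈ s ∩ t then w p else 0 := by
    intro u hu hsub p
    set w' : EuclideanSpace ℝ (Fin d) → ℝ := fun p => if p ∈ s ∩ t then w p else 0 with hw'
    have e1 : ∑ y ∈ s ∩ t, w y • y = ∑ y ∈ u, w' y • y := by
      rw [← Finset.sum_subset hsub (f := fun y => w' y • y)
        fun y _ hy => by simp only [hw', if_neg hy, zero_smul]]
      exact Finset.sum_congr rfl fun y hy => by simp only [hw', if_pos hy]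
    have e2 : ∑ y ∈ u, w' y = 1 := by
      rw [← hw1, ← Finset.sum_subset hsub (f := w')
        fun y _ hy => by simp only [hw', if_neg hy]]
      exact Finset.sum_congr rfl fun y hy => by simp only [hw', if_pos hy]
    by_cases hp : p ∈ u
    · rw [e1, baryCoord_sum_smul hu e2 hp]
    · rw [baryCoord_of_notMem hp, if_neg fun h => hp (hsub h)]
  refine ⟨fun p => ?_, fun p hp => ?_⟩
  · rw [key hs Finset.inter_subset_left, key ht Finset.inter_subset_right]
  · rw [key hs Finset.inter_subset_left, if_neg fun h => hp (Finset.mem_inter.1 h).2]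

/-- The Lipschitz constant of a barycentric coordinate is at most the reciprocal of the diameter of
the largest inscribed ball: the coordinate takes values in `[0, 1]` on this ball. -/
lemma baryCoord_sub_mul_inballDiam_le (hs : IsNondegenerateSimplex s)
    {p : EuclideanSpace ℝ (Fin d)} (hp : p ∈ s) (x y : EuclideanSpace ℝ (Fin d)) :
    |baryCoord s p x - baryCoord s p y| * inballDiam s ≤ dist x y := by
  set l := (baryCoord s p).linear with hl
  have hlin : ∀ a b, baryCoord s p a - baryCoord s p b = l (a - b) := fun a b => by
    rw [← vsub_eq_sub a b, hl, AffineMap.linearMap_vsub, vsub_eq_sub]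
  have hb : ∀ ρ : ℝ, (0 ≤ ρ ∧ ∃ c, Metric.closedBall c ρ ⊆ simplexHull s) →
      |l (x - y)| * (2 * ρ) ≤ ‖x - y‖ := by
    rintro ρ ⟨hρ, c, hc⟩
    rcases eq_or_ne (x - y) 0 with h0 | h0
    · simp [h0]
    have hn : 0 < ‖x - y‖ := norm_pos_iff.2 h0
    set v := (ρ / ‖x - y‖) • (x - y) with hv
    have hvn : ‖v‖ = ρ := by
      rw [hv, norm_smul, Real.norm_of_nonneg (by positivity), div_mul_cancel₀ _ hn.ne']
    have h1 := baryCoord_mem_Icc hs (hc (show c + v ∈ _ by simp [hvn])) hp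
    have h2 := baryCoord_mem_Icc hs (hc (show c - v ∈ _ by simp [hvn])) hp
    have h3 : baryCoord s p (c + v) - baryCoord s p (c - v) = 2 * (ρ / ‖x - y‖) * l (x - y) := by
      rw [hlin, show c + v - (c - v) = (2 * (ρ / ‖x - y‖)) • (x - y) by rw [hv]; module,
        map_smul, smul_eq_mul]
    have h4 : |2 * (ρ / ‖x - y‖) * l (x - y)| ≤ 1 := by
      rw [← h3, abs_le]
      constructor <;> linarith [h1.1, h1.2, h2.1, h2.2]
    rw [abs_mul, abs_of_nonneg (by positivity)] at h4
    calc |l (x - y)| * (2 * ρ) = (2 * (ρ / ‖x - y‖) * |l (x - y)|) * ‖x - y‖ := by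
          field_simp
      _ ≤ 1 * ‖x - y‖ := by gcongr
      _ = ‖x - y‖ := one_mul _
  rw [hlin, dist_eq_norm, inballDiam]
  rcases eq_or_lt_of_le (abs_nonneg (l (x - y))) with h0 | h0
  · rw [← h0, zero_mul]; positivity
  · have hne : {ρ : ℝ | 0 ≤ ρ ∧ ∃ c, Metric.closedBall c ρ ⊆ simplexHull s}.Nonempty := by
      obtain ⟨c, hc⟩ := nonempty_interior_simplexHull hs
      exact ⟨0, le_rfl, c, by simpa using interior_subset hc⟩
    have : sSup {ρ : ℝ | 0 ≤ ρ ∧ ∃ c, Metric.closedBall c ρ ⊆ simplexHull s} ≤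
        ‖x - y‖ / (2 * |l (x - y)|) := by
      refine csSup_le hne fun ρ hρ => ?_
      rw [le_div_iff₀ (by positivity)]
      linarith [hb ρ hρ]
    rw [le_div_iff₀ (by positivity)] at this
    linarith

end Simplex

/-! ### The Lagrange interpolant on a simplex -/

section LocalInterpolant

variable {d : ℕ}

/-- The point with barycentric coordinates `a p / r`, `p ∈ s`. -/
noncomputable def lagrangeNode (r : ℕ) (s : Finset (EuclideanSpace ℝ (Fin d)))
    (a : EuclideanSpace ℝ (Fin d) → ℕ) : EuclideanSpace ℝ (Fin d) :=
  ∑ p ∈ s, ((a p : ℝ) / (r : ℝ)) • p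

open Classical in
/-- The polynomial of degree at most `r` with the same values as `w` at the Lagrange nodes of the
simplex with vertex set `s`. -/
noncomputable def localInterp (r : ℕ) (s : Finset (EuclideanSpace ℝ (Fin d)))
    (w : EuclideanSpace ℝ (Fin d) → ℝ) (x : EuclideanSpace ℝ (Fin d)) : ℝ :=
  ∑ a ∈ Finset.piAntidiag s r, w (lagrangeNode r s a) *
    ∏ p ∈ s, nodeFactor r (a p) (baryCoord s p x)

variable {r : ℕ} {s t : Finset (EuclideanSpace ℝ (Fin d))}

lemma lagrangeNode_mem_lagrangeNodes {a : EuclideanSpace ℝ (Fin d) → ℕ} (ha : ∑ p ∈ s, a p = r) :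
    lagrangeNode r s a ∈ lagrangeNodes r s := ⟨a, ha, rfl⟩

lemma sum_div_eq_one (hr : 1 ≤ r) {ι : Type*} {s : Finset ι} {a : ι → ℕ} (ha : ∑ p ∈ s, a p = r) :
    ∑ p ∈ s, (a p : ℝ) / r = 1 := by
  have hr' : (r : ℝ) ≠ 0 := by positivity
  rw [← Finset.sum_div, ← Nat.cast_sum, ha, div_self hr']

lemma lagrangeNode_mem_simplexHull (hr : 1 ≤ r) {a : EuclideanSpace ℝ (Fin d) → ℕ}
    (ha : ∑ p ∈ s, a p = r) : lagrangeNode r s a ∈ simplexHull s := by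
  rw [simplexHull, Finset.mem_convexHull']
  exact ⟨fun p => (a p : ℝ) / r, fun _ _ => by positivity, sum_div_eq_one hr ha, rfl⟩

lemma lagrangeNodes_subset_simplexHull (hr : 1 ≤ r) (s : Finset (EuclideanSpace ℝ (Fin d))) :
    lagrangeNodes r s ⊆ simplexHull s := by
  rintro x ⟨a, ha, rfl⟩
  exact lagrangeNode_mem_simplexHull hr ha

lemma baryCoord_lagrangeNode (hr : 1 ≤ r) (hs : IsNondegenerateSimplex s)
    {a : EuclideanSpace ℝ (Fin d) → ℕ} (ha : ∑ p ∈ s, a p = r) {p : EuclideanSpace ℝ (Fin d)}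
    (hp : p ∈ s) : baryCoord s p (lagrangeNode r s a) = (a p : ℝ) / r :=
  baryCoord_sum_smul hs (w := fun p => (a p : ℝ) / r) (sum_div_eq_one hr ha) hp

lemma localInterp_of_mem_lagrangeNodes (hr : 1 ≤ r) (hs : IsNondegenerateSimplex s)
    (w : EuclideanSpace ℝ (Fin d) → ℝ) {x : EuclideanSpace ℝ (Fin d)}
    (hx : x ∈ lagrangeNodes r s) : localInterp r s w x = w x := by
  classical
  obtain ⟨b, hb, rfl⟩ := hx
  change localInterp r s w (lagrangeNode r s b) = w (lagrangeNode r s b)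
  -- the part of the multi-index outside `s` is irrelevant
  set b' : EuclideanSpace ℝ (Fin d) → ℕ := fun p => if p ∈ s then b p else 0 with hb'
  have hbb : ∀ p ∈ s, b' p = b p := fun p hp => by simp [hb', hp]
  have hsum : ∑ p ∈ s, b' p = r := by rw [Finset.sum_congr rfl hbb, hb]
  have hnode : lagrangeNode r s b' = lagrangeNode r s b :=
    Finset.sum_congr rfl fun p hp => by rw [hbb p hp]
  have hmem : b' ∈ Finset.piAntidiag s r := by
    rw [Finset.mem_piAntidiag]
    refine ⟨hsum, fun p hp => ?_⟩
    by_contra h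
    exact hp (by simp [hb', h])
  rw [← hnode, localInterp, Finset.sum_eq_single_of_mem b' hmem]
  · rw [Finset.prod_congr rfl fun p hp => by rw [baryCoord_lagrangeNode hr hs hsum hp],
      prod_nodeFactor_div hr rfl]
    simp
  · intro a ha hab
    obtain ⟨ha1, ha2⟩ := Finset.mem_piAntidiag.1 ha
    rw [Finset.prod_congr rfl fun p hp => by rw [baryCoord_lagrangeNode hr hs hsum hp],
      prod_nodeFactor_div hr (by rw [ha1, hsum]), if_neg, mul_zero]
    intro h
    refine hab (funext fun p => ?_)
    by_cases hp : p ∈ s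
    · exact h p hp
    · simp only [hb', if_neg hp]
      by_contra h'
      exact hp (ha2 p h')

lemma IsPolynomialOn.mono {S S' : Set (EuclideanSpace ℝ (Fin d))}
    {v : EuclideanSpace ℝ (Fin d) → ℝ} (h : IsPolynomialOn r S v) (hS : S' ⊆ S) :
    IsPolynomialOn r S' v := by
  obtain ⟨p, hp, hv⟩ := h
  exact ⟨p, hp, fun x hx => hv x (hS hx)⟩

lemma isPolynomialOn_affineMap (l : EuclideanSpace ℝ (Fin d) →ᵃ[ℝ] ℝ) :
    IsPolynomialOn 1 univ l := by
  refine ⟨MvPolynomial.C (l 0) + ∑ i, MvPolynomial.C (l.linear (EuclideanSpace.single i 1)) *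
    MvPolynomial.X i, ?_, fun x _ => ?_⟩
  · refine (MvPolynomial.totalDegree_add _ _).trans (max_le (by simp) ?_)
    refine MvPolynomial.totalDegree_finsetSum_le fun i _ => ?_
    refine (MvPolynomial.totalDegree_mul _ _).trans ?_
    simp
  · have h1 : l x = l.linear x + l 0 := by
      have := congrFun l.decomp x
      simpa using this
    have h2 : l.linear x = ∑ i, x i * l.linear (EuclideanSpace.single i 1) := by
      conv_lhs => rw [← (EuclideanSpace.basisFun (Fin d) ℝ).sum_repr x]
      simp
    rw [h1, h2]
    simp [add_comm, mul_comm]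

lemma IsPolynomialOn.mul {m n : ℕ} {S : Set (EuclideanSpace ℝ (Fin d))}
    {v w : EuclideanSpace ℝ (Fin d) → ℝ} (hv : IsPolynomialOn m S v) (hw : IsPolynomialOn n S w) :
    IsPolynomialOn (m + n) S (fun x => v x * w x) := by
  obtain ⟨p, hp, hpv⟩ := hv
  obtain ⟨q, hq, hqw⟩ := hw
  exact ⟨p * q, (MvPolynomial.totalDegree_mul p q).trans (add_le_add hp hq),
    fun x hx => by simp [hpv x hx, hqw x hx]⟩

lemma IsPolynomialOn.prod {ι : Type*} (u : Finset ι) {n : ι → ℕ}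
    {S : Set (EuclideanSpace ℝ (Fin d))} {v : ι → EuclideanSpace ℝ (Fin d) → ℝ}
    (hv : ∀ i ∈ u, IsPolynomialOn (n i) S (v i)) :
    IsPolynomialOn (∑ i ∈ u, n i) S (fun x => ∏ i ∈ u, v i x) := by
  classical
  induction u using Finset.induction_on with
  | empty => exact ⟨1, by simp, by simp⟩
  | insert i u hi ih =>
    simp only [Finset.sum_insert hi, Finset.prod_insert hi]
    exact (hv i (Finset.mem_insert_self _ _)).mul
      (ih fun j hj => hv j (Finset.mem_insert_of_mem hj))

lemma IsPolynomialOn.sum {ι : Type*} (u : Finset ι) {n : ℕ} {S : Set (EuclideanSpace ℝ (Fin d))}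
    {v : ι → EuclideanSpace ℝ (Fin d) → ℝ} (hv : ∀ i ∈ u, IsPolynomialOn n S (v i)) :
    IsPolynomialOn n S (fun x => ∑ i ∈ u, v i x) := by
  choose! p hp hpv using hv
  exact ⟨∑ i ∈ u, p i, MvPolynomial.totalDegree_finsetSum_le hp, fun x hx => by
    rw [map_sum]; exact Finset.sum_congr rfl fun i hi => hpv i hi x hx⟩

lemma IsPolynomialOn.sub {n : ℕ} {S : Set (EuclideanSpace ℝ (Fin d))}
    {v w : EuclideanSpace ℝ (Fin d) → ℝ} (hv : IsPolynomialOn n S v) (hw : IsPolynomialOn n S w) :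
    IsPolynomialOn n S (fun x => v x - w x) := by
  obtain ⟨p, hp, hpv⟩ := hv
  obtain ⟨q, hq, hqw⟩ := hw
  exact ⟨p - q, (MvPolynomial.totalDegree_sub p q).trans (max_le hp hq),
    fun x hx => by simp [hpv x hx, hqw x hx]⟩

lemma isPolynomialOn_const (n : ℕ) (S : Set (EuclideanSpace ℝ (Fin d))) (c : ℝ) :
    IsPolynomialOn n S (fun _ => c) :=
  ⟨MvPolynomial.C c, by simp, by simp⟩

lemma isPolynomialOn_localInterp (r : ℕ) (s : Finset (EuclideanSpace ℝ (Fin d)))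
    (w : EuclideanSpace ℝ (Fin d) → ℝ) : IsPolynomialOn r univ (localInterp r s w) := by
  classical
  refine IsPolynomialOn.sum _ fun a ha => ?_
  have h2 : ∀ p ∈ s, IsPolynomialOn (a p) univ fun x => nodeFactor r (a p) (baryCoord s p x) := by
    intro p _
    have := IsPolynomialOn.prod (Finset.range (a p)) (n := fun _ => 0 + 1) (S := univ)
      (v := fun (j : ℕ) x => ((a p : ℝ) - j)⁻¹ * ((r • baryCoord s p) - AffineMap.const ℝ _ (j : ℝ) :
        EuclideanSpace ℝ (Fin d) →ᵃ[ℝ] ℝ) x)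
      fun j _ => (isPolynomialOn_const 0 _ _).mul (isPolynomialOn_affineMap _)
    simpa [nodeFactor, div_eq_inv_mul] using this
  have h3 := (isPolynomialOn_const 0 univ (w (lagrangeNode r s a))).mul (IsPolynomialOn.prod s h2)
  rwa [(Finset.mem_piAntidiag.1 ha).1, zero_add] at h3

lemma continuous_localInterp (r : ℕ) (s : Finset (EuclideanSpace ℝ (Fin d)))
    (w : EuclideanSpace ℝ (Fin d) → ℝ) : Continuous (localInterp r s w) := by
  obtain ⟨p, -, hp⟩ := isPolynomialOn_localInterp r s w
  rw [show localInterp r s w = fun x => MvPolynomial.eval (fun i => x i) p from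
    funext fun x => hp x (mem_univ x)]
  exact (MvPolynomial.continuous_eval p).comp (by fun_prop)

/-- The interpolants on two simplices agree on the common face: there, the basis functions of all
nodes outside the face vanish. -/
lemma localInterp_eq_of_mem_inter (hs : IsNondegenerateSimplex s) (ht : IsNondegenerateSimplex t)
    (w : EuclideanSpace ℝ (Fin d) → ℝ) {x : EuclideanSpace ℝ (Fin d)}
    (hx : x ∈ convexHull ℝ ((s : Set (EuclideanSpace ℝ (Fin d))) ∩ t)) :
    localInterp r s w x = localInterp r t w x := by
  classical
  obtain ⟨hst, hs0⟩ := baryCoord_eq_of_mem_inter hs ht hx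
  have key : ∀ {u : Finset (EuclideanSpace ℝ (Fin d))}, s ∩ t ⊆ u →
      (∀ p, baryCoord u p x = baryCoord s p x) → localInterp r u w x =
        ∑ a ∈ Finset.piAntidiag (s ∩ t) r, w (lagrangeNode r (s ∩ t) a) *
          ∏ p ∈ s ∩ t, nodeFactor r (a p) (baryCoord s p x) := by
    intro u hu hux
    have hsub : Finset.piAntidiag (s ∩ t) r ⊆ Finset.piAntidiag u r := fun a ha => by
      obtain ⟨h1, h2⟩ := Finset.mem_piAntidiag.1 ha
      refine Finset.mem_piAntidiag.2 ⟨?_, fun p hp => hu (h2 p hp)⟩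
      rw [← h1, Finset.sum_subset hu]
      intro p _ hp
      by_contra h
      exact hp (h2 p h)
    rw [localInterp, ← Finset.sum_subset hsub]
    · refine Finset.sum_congr rfl fun a ha => ?_
      have ha0 : ∀ p, p ∉ s ∩ t → a p = 0 := fun p hp => by
        by_contra h
        exact hp ((Finset.mem_piAntidiag.1 ha).2 p h)
      congr 1
      · rw [lagrangeNode, lagrangeNode, ← Finset.sum_subset hu]
        intro p _ hp
        simp [ha0 p hp]
      · rw [← Finset.prod_subset hu fun p _ hp => by simp [ha0 p hp]]
        simp only [hux]
    · intro a ha ha'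
      obtain ⟨h1, h2⟩ := Finset.mem_piAntidiag.1 ha
      have : ∃ p ∈ u, p ∉ s ∩ t ∧ a p ≠ 0 := by
        by_contra! h
        refine ha' (Finset.mem_piAntidiag.2 ⟨?_, fun p hp => ?_⟩)
        · rw [← h1, Finset.sum_subset hu fun p hp hp' => h p hp hp']
        · by_contra hp'
          exact hp (h p (h2 p hp) hp')
      obtain ⟨p, hpu, hp, hap⟩ := this
      refine mul_eq_zero_of_right _ (Finset.prod_eq_zero hpu ?_)
      have : baryCoord s p x = 0 := by
        by_cases hpt : p ∈ t
        · exact baryCoord_of_notMem (fun hps => hp (Finset.mem_inter.2 ⟨hps, hpt⟩)) x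
        · exact hs0 p hpt
      rw [hux, this, nodeFactor_zero_right r hap]
  rw [key Finset.inter_subset_left fun _ => rfl, key Finset.inter_subset_right fun p => (hst p).symm]

/-- Unisolvence of the Lagrange nodes: a polynomial of degree at most `r` which vanishes at the
Lagrange nodes of a simplex is zero on the simplex. -/
theorem IsPolynomialOn.eq_zero_of_lagrangeNodes (hr : 1 ≤ r) (hs : IsNondegenerateSimplex s)
    {v : EuclideanSpace ℝ (Fin d) → ℝ} (hv : IsPolynomialOn r (simplexHull s) v)
    (h0 : ∀ x ∈ lagrangeNodes r s, v x = 0) {x : EuclideanSpace ℝ (Fin d)}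
    (hx : x ∈ simplexHull s) : v x = 0 := by
  classical
  obtain ⟨p, hp, hpv⟩ := hv
  obtain ⟨P, hP, hPp⟩ := exists_isHomogeneous_eval_eq (fun (q : s) k => q.1 k) hp
  have hev : ∀ l : EuclideanSpace ℝ (Fin d) → ℝ, ∑ q ∈ s, l q = 1 →
      MvPolynomial.eval (fun i => (∑ q ∈ s, l q • q : EuclideanSpace ℝ (Fin d)) i) p =
        MvPolynomial.eval (fun q : s => l q) P := by
    intro l hl
    rw [← hPp _ (by rwa [Finset.sum_coe_sort s l])]
    congr 1
    congr 1
    ext k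
    rw [Finset.sum_coe_sort s fun q => l q * q k]
    simp
  rw [hpv x hx]
  conv_lhs => rw [← sum_baryCoord_smul hs x]
  rw [hev _ (sum_baryCoord hs x)]
  refine isHomogeneous_eval_eq_zero hr hP (fun a ha => ?_) _
  have ha1 : ∑ q : s, a q = r := (Finset.mem_finsuppAntidiag.1 ha).1
  set b : EuclideanSpace ℝ (Fin d) → ℕ := fun q => if h : q ∈ s then a ⟨q, h⟩ else 0 with hb
  have hba : ∀ q : s, b q = a q := fun q => by simp [hb]
  have hb1 : ∑ q ∈ s, b q = r := by
    rw [← Finset.sum_coe_sort s, ← ha1]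
    exact Finset.sum_congr rfl fun q _ => hba q
  have h1 := hev _ (sum_div_eq_one hr hb1)
  simp only [hba] at h1
  rw [← h1]
  have h2 := lagrangeNode_mem_lagrangeNodes hb1
  have h3 := hpv _ (lagrangeNode_mem_simplexHull hr hb1)
  rw [h0 _ h2] at h3
  exact h3.symm

lemma IsPolynomialOn.eq_localInterp (hr : 1 ≤ r) (hs : IsNondegenerateSimplex s)
    {v w : EuclideanSpace ℝ (Fin d) → ℝ} (hv : IsPolynomialOn r (simplexHull s) v)
    (hw : ∀ x ∈ lagrangeNodes r s, v x = w x) {x : EuclideanSpace ℝ (Fin d)}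
    (hx : x ∈ simplexHull s) : v x = localInterp r s w x := by
  have := (hv.sub ((isPolynomialOn_localInterp r s w).mono (subset_univ _))).eq_zero_of_lagrangeNodes
    hr hs (fun y hy => by
      rw [hw y hy, localInterp_of_mem_lagrangeNodes hr hs w hy, sub_self]) hx
  linarith

end LocalInterpolant

/-! ### Stability of the Lagrange interpolant -/

lemma exists_nodeFactor_bound (r : ℕ) : ∃ M : ℝ, 1 ≤ M ∧ ∀ n ≤ r, ∀ t ∈ Icc (0 : ℝ) 1,
    |nodeFactor r n t| ≤ M ∧
      ∀ t' ∈ Icc (0 : ℝ) 1, |nodeFactor r n t - nodeFactor r n t'| ≤ M * |t - t'| := by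
  have hC : ∀ n, ContDiff ℝ 1 (nodeFactor r n) := fun n => by
    unfold nodeFactor
    fun_prop
  choose B hB using fun n => isCompact_Icc.exists_bound_of_continuousOn (s := Icc (0 : ℝ) 1)
    (hC n).continuous.continuousOn
  choose K hK using fun n => (hC n).contDiffOn.exists_lipschitzOnWith (s := Icc (0 : ℝ) 1)
    one_ne_zero (convex_Icc 0 1) isCompact_Icc
  have hB0 : ∀ n, 0 ≤ B n := fun n => (norm_nonneg _).trans (hB n 0 (by simp))
  refine ⟨1 + ∑ n ∈ Finset.range (r + 1), (B n + K n), ?_, fun n hn t ht => ⟨?_, fun t' ht' => ?_⟩⟩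
  · have : 0 ≤ ∑ n ∈ Finset.range (r + 1), (B n + K n) :=
      Finset.sum_nonneg fun n _ => add_nonneg (hB0 n) (K n).2
    linarith
  all_goals
    have h1 : B n + K n ≤ ∑ n ∈ Finset.range (r + 1), (B n + K n) :=
      Finset.single_le_sum (f := fun n => B n + (K n : ℝ))
        (fun n _ => add_nonneg (hB0 n) (K n).2) (Finset.mem_range.2 (by omega))
  · have := hB n t ht
    rw [Real.norm_eq_abs] at this
    linarith [(K n).2]
  · have := (hK n).dist_le_mul t ht t' ht'
    rw [Real.dist_eq, Real.dist_eq] at this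
    refine this.trans ?_
    gcongr
    linarith [hB0 n]

lemma abs_prod_le_pow_card {ι : Type*} (s : Finset ι) {f : ι → ℝ} {M : ℝ}
    (hf : ∀ i ∈ s, |f i| ≤ M) : |∏ i ∈ s, f i| ≤ M ^ s.card := by
  rw [Finset.abs_prod, ← Finset.prod_const]
  exact Finset.prod_le_prod (fun i _ => abs_nonneg _) hf

lemma abs_prod_sub_prod_le {ι : Type*} (s : Finset ι) {f g : ι → ℝ} {M δ : ℝ} (hM : 1 ≤ M)
    (hδ : 0 ≤ δ) (hf : ∀ i ∈ s, |f i| ≤ M) (hg : ∀ i ∈ s, |g i| ≤ M)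
    (hfg : ∀ i ∈ s, |f i - g i| ≤ δ) :
    |∏ i ∈ s, f i - ∏ i ∈ s, g i| ≤ s.card * M ^ s.card * δ := by
  classical
  induction s using Finset.induction_on with
  | empty => simp
  | insert i s hi ih =>
    have ih' := ih (fun j hj => hf j (Finset.mem_insert_of_mem hj))
      (fun j hj => hg j (Finset.mem_insert_of_mem hj))
      (fun j hj => hfg j (Finset.mem_insert_of_mem hj))
    have hF : |∏ j ∈ s, f j| ≤ M ^ s.card :=
      abs_prod_le_pow_card s fun j hj => hf j (Finset.mem_insert_of_mem hj)
    rw [Finset.prod_insert hi, Finset.prod_insert hi, Finset.card_insert_of_notMem hi]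
    have h1 : M ^ s.card ≤ M ^ (s.card + 1) := pow_le_pow_right₀ hM (Nat.le_succ _)
    calc |f i * ∏ j ∈ s, f j - g i * ∏ j ∈ s, g j|
        = |(f i - g i) * ∏ j ∈ s, f j + g i * (∏ j ∈ s, f j - ∏ j ∈ s, g j)| := by ring_nf
      _ ≤ |f i - g i| * |∏ j ∈ s, f j| + |g i| * |∏ j ∈ s, f j - ∏ j ∈ s, g j| := by
          rw [← abs_mul, ← abs_mul]; exact abs_add_le _ _
      _ ≤ δ * M ^ (s.card + 1) + M * (s.card * M ^ s.card * δ) := by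
          gcongr
          · exact hfg i (Finset.mem_insert_self _ _)
          · exact hF.trans h1
          · exact hg i (Finset.mem_insert_self _ _)
      _ = ((s.card + 1 : ℕ) : ℝ) * M ^ (s.card + 1) * δ := by push_cast; ring

lemma card_piAntidiag_le {ι : Type*} [DecidableEq ι] (s : Finset ι) (r : ℕ) :
    (Finset.piAntidiag s r).card ≤ (r + 1) ^ s.card := by
  have h : (s.pi fun _ => Finset.range (r + 1)).card = (r + 1) ^ s.card := by
    rw [Finset.card_pi]; simp
  rw [← h]
  refine Finset.card_le_card_of_injOn (fun a p _ => a p) (fun a ha => ?_) fun a ha b hb hab => ?_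
  · rw [Finset.mem_coe, Finset.mem_piAntidiag] at ha
    rw [Finset.mem_coe, Finset.mem_pi]
    intro p hp
    rw [Finset.mem_range, Nat.lt_succ_iff, ← ha.1]
    exact Finset.single_le_sum (fun _ _ => Nat.zero_le _) hp
  · rw [Finset.mem_coe, Finset.mem_piAntidiag] at ha hb
    funext p
    by_cases hp : p ∈ s
    · exact congrFun (congrFun hab p) hp
    · rw [show a p = 0 from by_contra fun h => hp (ha.2 p h),
        show b p = 0 from by_contra fun h => hp (hb.2 p h)]

/-- The Lagrange interpolant is bounded by the nodal values, and it is Lipschitz with respect to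
the barycentric coordinates, with a constant which is independent of the simplex. -/
theorem exists_localInterp_bound (d r : ℕ) : ∃ C : ℝ, 0 ≤ C ∧
    ∀ s : Finset (EuclideanSpace ℝ (Fin d)), IsNondegenerateSimplex s →
    ∀ (w : EuclideanSpace ℝ (Fin d) → ℝ) (B : ℝ), 0 ≤ B → (∀ x ∈ lagrangeNodes r s, |w x| ≤ B) →
    ∀ x ∈ simplexHull s, |localInterp r s w x| ≤ C * B ∧
      ∀ y ∈ simplexHull s, ∀ δ, 0 ≤ δ →
        (∀ p ∈ s, |baryCoord s p x - baryCoord s p y| ≤ δ) →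
        |localInterp r s w x - localInterp r s w y| ≤ C * B * δ := by
  classical
  obtain ⟨M, hM1, hM⟩ := exists_nodeFactor_bound r
  have hM0 : 0 ≤ M := by linarith
  set n : ℕ := d + 1 with hn
  set N : ℝ := (((r + 1) ^ n : ℕ) : ℝ) with hN
  refine ⟨N * (n * M ^ (n + 1)), by positivity, fun s hs w B hB hw x hx => ?_⟩
  have hcard : ((Finset.piAntidiag s r).card : ℝ) ≤ N := by
    rw [hN, hn, ← hs.2]; exact_mod_cast card_piAntidiag_le s r
  have hle : ∀ a ∈ Finset.piAntidiag s r, ∀ p ∈ s, a p ≤ r := fun a ha p hp => by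
    rw [← (Finset.mem_piAntidiag.1 ha).1]
    exact Finset.single_le_sum (fun _ _ => Nat.zero_le _) hp
  have hwa : ∀ a ∈ Finset.piAntidiag s r, |w (lagrangeNode r s a)| ≤ B := fun a ha =>
    hw _ (lagrangeNode_mem_lagrangeNodes (Finset.mem_piAntidiag.1 ha).1)
  have hsum : ∀ (F : (EuclideanSpace ℝ (Fin d) → ℕ) → ℝ) (b : ℝ), 0 ≤ b →
      (∀ a ∈ Finset.piAntidiag s r, |F a| ≤ b) →
      |∑ a ∈ Finset.piAntidiag s r, F a| ≤ N * b := fun F b hb hF => by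
    refine (Finset.abs_sum_le_sum_abs _ _).trans ((Finset.sum_le_card_nsmul _ _ b hF).trans ?_)
    rw [nsmul_eq_mul]
    gcongr
  have hnf : ∀ a ∈ Finset.piAntidiag s r, ∀ z ∈ simplexHull s, ∀ p ∈ s,
      |nodeFactor r (a p) (baryCoord s p z)| ≤ M := fun a ha z hz p hp =>
    (hM _ (hle a ha p hp) _ (baryCoord_mem_Icc hs hz hp)).1
  constructor
  · refine (hsum _ (B * (n * M ^ (n + 1))) (by positivity) fun a ha => ?_).trans_eq (by ring)
    rw [abs_mul]
    gcongr
    · exact hwa a ha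
    · refine (abs_prod_le_pow_card s (hnf a ha x hx)).trans ?_
      rw [hs.2, ← hn]
      have h1 : M ^ n ≤ M ^ (n + 1) := pow_le_pow_right₀ hM1 (Nat.le_succ _)
      have h2 : (1 : ℝ) ≤ n := by rw [hn]; push_cast; linarith [(Nat.cast_nonneg d : (0 : ℝ) ≤ d)]
      nlinarith [pow_nonneg hM0 (n + 1)]
  · intro y hy δ hδ hxy
    rw [localInterp, localInterp, ← Finset.sum_sub_distrib]
    refine (hsum _ (B * (n * M ^ (n + 1) * δ)) (by positivity) fun a ha => ?_).trans_eq (by ring)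
    rw [← mul_sub, abs_mul]
    gcongr
    · exact hwa a ha
    · have := abs_prod_sub_prod_le s hM1 (mul_nonneg hM0 hδ) (hnf a ha x hx) (hnf a ha y hy)
        fun p hp => ((hM _ (hle a ha p hp) _ (baryCoord_mem_Icc hs hx hp)).2 _
          (baryCoord_mem_Icc hs hy hp)).trans (mul_le_mul_of_nonneg_left (hxy p hp) hM0)
      refine this.trans_eq ?_
      rw [hs.2, ← hn, pow_succ]
      ring

/-! ### The finite element interpolant on a mesh -/

section Interpolant

variable {d r : ℕ} {Ω : Set (EuclideanSpace ℝ (Fin d))}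
  {T : Geometry.SimplicialComplex ℝ (EuclideanSpace ℝ (Fin d))}
  {s : Finset (EuclideanSpace ℝ (Fin d))} {v v' w w' : EuclideanSpace ℝ (Fin d) → ℝ}

lemma isNondegenerateSimplex_of_mem_meshElements (hs : s ∈ meshElements T) :
    IsNondegenerateSimplex s := ⟨T.indep hs.1, hs.2⟩

lemma IsSimplicialMesh.finite_meshElements (hT : IsSimplicialMesh Ω T) :
    (meshElements T).Finite :=
  hT.1.subset fun _ hs => hs.1

lemma IsSimplicialMesh.simplexHull_subset (hT : IsSimplicialMesh Ω T) (hs : s ∈ meshElements T) :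
    simplexHull s ⊆ closure Ω := by
  rw [← hT.2.2]
  exact subset_biUnion_of_mem (u := simplexHull) hs

lemma IsSimplicialMesh.exists_mem_simplexHull (hT : IsSimplicialMesh Ω T)
    {x : EuclideanSpace ℝ (Fin d)} (hx : x ∈ closure Ω) :
    ∃ s ∈ meshElements T, x ∈ simplexHull s := by
  rw [← hT.2.2] at hx
  simpa using hx

lemma IsSimplicialMesh.lagrangeNodes_subset (hr : 1 ≤ r) (hT : IsSimplicialMesh Ω T)
    (hs : s ∈ meshElements T) : lagrangeNodes r s ⊆ closure Ω :=
  (lagrangeNodes_subset_simplexHull hr s).trans (hT.simplexHull_subset hs)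

lemma localInterp_eq_of_mem_meshElements {t : Finset (EuclideanSpace ℝ (Fin d))}
    (hs : s ∈ meshElements T) (ht : t ∈ meshElements T)
    (w : EuclideanSpace ℝ (Fin d) → ℝ) {x : EuclideanSpace ℝ (Fin d)}
    (hxs : x ∈ simplexHull s) (hxt : x ∈ simplexHull t) :
    localInterp r s w x = localInterp r t w x :=
  localInterp_eq_of_mem_inter (isNondegenerateSimplex_of_mem_meshElements hs)
    (isNondegenerateSimplex_of_mem_meshElements ht) w
    (T.inter_subset_convexHull hs.1 ht.1 ⟨hxs, hxt⟩)

lemma IsFEInterpolant.eq_localInterp (hr : 1 ≤ r) (h : IsFEInterpolant Ω T r w v)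
    (hs : s ∈ meshElements T) {x : EuclideanSpace ℝ (Fin d)} (hx : x ∈ simplexHull s) :
    v x = localInterp r s w x :=
  (h.1.2.2 s hs).eq_localInterp hr (isNondegenerateSimplex_of_mem_meshElements hs) (h.2 s hs) hx

/-- The interpolant only depends on the values on `closure Ω`. -/
lemma IsFEInterpolant.eq_of_eqOn (hr : 1 ≤ r) (hT : IsSimplicialMesh Ω T)
    (h : IsFEInterpolant Ω T r w v) (h' : IsFEInterpolant Ω T r w' v')
    (hw : EqOn w w' (closure Ω)) : v = v' := by
  funext x
  by_cases hx : x ∈ closure Ω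
  · obtain ⟨s, hs, hxs⟩ := hT.exists_mem_simplexHull hx
    rw [h'.eq_localInterp hr hs hxs]
    refine (h.1.2.2 s hs).eq_localInterp hr (isNondegenerateSimplex_of_mem_meshElements hs)
      (fun y hy => ?_) hxs
    rw [h.2 s hs y hy, hw (hT.lagrangeNodes_subset hr hs hy)]
  · rw [h.1.2.1 x hx, h'.1.2.1 x hx]

lemma exists_isFEInterpolant (hr : 1 ≤ r) (hT : IsSimplicialMesh Ω T)
    (w : EuclideanSpace ℝ (Fin d) → ℝ) : ∃ v, IsFEInterpolant Ω T r w v := by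
  classical
  choose! S hS hxS using fun x (hx : x ∈ closure Ω) => hT.exists_mem_simplexHull hx
  set v : EuclideanSpace ℝ (Fin d) → ℝ :=
    fun x => if x ∈ closure Ω then localInterp r (S x) w x else 0 with hv
  have hvs : ∀ s ∈ meshElements T, ∀ x ∈ simplexHull s, v x = localInterp r s w x := by
    intro s hs x hx
    have hxΩ := hT.simplexHull_subset hs hx
    simp only [hv, if_pos hxΩ]
    exact localInterp_eq_of_mem_meshElements (hS x hxΩ) hs w (hxS x hxΩ) hx
  refine ⟨v, ⟨?_, fun x hx => by simp only [hv, if_neg hx], fun s hs => ?_⟩, fun s hs x hx => ?_⟩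
  · have : Finite (meshElements T) := hT.finite_meshElements
    have h := (locallyFinite_of_finite fun s : meshElements T => simplexHull s.1).continuousOn_iUnion
      (g := v) (fun s => (isCompact_simplexHull s.1).isClosed) fun s =>
        (continuous_localInterp r s.1 w).continuousOn.congr fun x hx => hvs s.1 s.2 x hx
    rwa [← hT.2.2, biUnion_eq_iUnion]
  · obtain ⟨p, hp, hpv⟩ := (isPolynomialOn_localInterp r s w).mono (subset_univ (simplexHull s))
    exact ⟨p, hp, fun x hx => by rw [hvs s hs x hx, hpv x hx]⟩
  · rw [hvs s hs x (lagrangeNodes_subset_simplexHull hr s hx)]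
    exact localInterp_of_mem_lagrangeNodes hr (isNondegenerateSimplex_of_mem_meshElements hs) w hx

theorem existsUnique_isFEInterpolant (hr : 1 ≤ r) (hT : IsSimplicialMesh Ω T)
    (w : EuclideanSpace ℝ (Fin d) → ℝ) : ∃! v, IsFEInterpolant Ω T r w v := by
  obtain ⟨v, hv⟩ := exists_isFEInterpolant hr hT w
  exact ⟨v, hv, fun v' hv' => hv'.eq_of_eqOn hr hT hv fun _ _ => rfl⟩

lemma isFEInterpolant_self (hv : v ∈ feSpace Ω T r) : IsFEInterpolant Ω T r v v :=
  ⟨hv, fun _ _ _ _ => rfl⟩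

lemma IsFEInterpolant.add (h : IsFEInterpolant Ω T r w v) (h' : IsFEInterpolant Ω T r w' v') :
    IsFEInterpolant Ω T r (w + w') (v + v') :=
  ⟨add_mem h.1 h'.1, fun s hs x hx => by simp [h.2 s hs x hx, h'.2 s hs x hx]⟩

lemma IsFEInterpolant.smul (c : ℝ) (h : IsFEInterpolant Ω T r w v) :
    IsFEInterpolant Ω T r (c • w) (c • v) :=
  ⟨Submodule.smul_mem _ c h.1, fun s hs x hx => by simp [h.2 s hs x hx]⟩

lemma IsFEInterpolant.sum {ι : Type*} (u : Finset ι) {v w : ι → EuclideanSpace ℝ (Fin d) → ℝ}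
    (h : ∀ i ∈ u, IsFEInterpolant Ω T r (w i) (v i)) :
    IsFEInterpolant Ω T r (∑ i ∈ u, w i) (∑ i ∈ u, v i) :=
  ⟨sum_mem fun i hi => (h i hi).1, fun s hs x hx => by
    rw [Finset.sum_apply, Finset.sum_apply]
    exact Finset.sum_congr rfl fun i hi => (h i hi).2 s hs x hx⟩

lemma isLinearMap_of_isFEInterpolant (hr : 1 ≤ r) (hT : IsSimplicialMesh Ω T)
    {I : (EuclideanSpace ℝ (Fin d) → ℝ) → EuclideanSpace ℝ (Fin d) → ℝ}
    (hI : ∀ w, IsFEInterpolant Ω T r w (I w)) : IsLinearMap ℝ I where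
  map_add w w' := (hI _).eq_of_eqOn hr hT ((hI w).add (hI w')) fun _ _ => rfl
  map_smul c w := (hI _).eq_of_eqOn hr hT ((hI w).smul c) fun _ _ => rfl

/-- If all nodal values of `w` on an element agree, then its interpolant is constant there. -/
lemma IsFEInterpolant.eq_const (hr : 1 ≤ r) (h : IsFEInterpolant Ω T r w v)
    (hs : s ∈ meshElements T) {c : ℝ} (hc : ∀ x ∈ lagrangeNodes r s, w x = c)
    {x : EuclideanSpace ℝ (Fin d)} (hx : x ∈ simplexHull s) : v x = c := by
  have := ((h.1.2.2 s hs).sub (isPolynomialOn_const r _ c)).eq_zero_of_lagrangeNodes hr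
    (isNondegenerateSimplex_of_mem_meshElements hs)
    (fun y hy => by rw [h.2 s hs y hy, hc y hy, sub_self]) hx
  linarith

end Interpolant

/-! ### Weak gradients of piecewise Lipschitz functions -/

/-- A continuous function on `[0, 1]` which is `L`-Lipschitz on each of finitely many closed sets
covering `[0, 1]` grows at most linearly, with slope `L`. -/
lemma abs_sub_le_of_finite_closed_cover {ι : Type*} [Finite ι] {g : ℝ → ℝ} {L : ℝ}
    (hg : ContinuousOn g (Icc 0 1)) {F : ι → Set ℝ} (hF : ∀ i, IsClosed (F i))
    (hcov : Icc (0 : ℝ) 1 ⊆ ⋃ i, F i)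
    (hL : ∀ i, ∀ t ∈ F i ∩ Icc 0 1, ∀ t' ∈ F i ∩ Icc 0 1, |g t - g t'| ≤ L * |t - t'|) :
    |g 1 - g 0| ≤ L := by
  have hclosed : IsClosed ({t | |g t - g 0| ≤ L * t} ∩ Icc 0 1) := by
    have h := isClosed_Icc.isClosed_le (hg.sub (continuousOn_const (c := g 0))).abs
      (by fun_prop : ContinuousOn (fun t => L * t) (Icc 0 1))
    rw [inter_comm]
    exact h
  have hsub := hclosed.Icc_subset_of_forall_exists_gt (a := 0) (b := 1) (by simp) ?_
  · simpa using hsub (right_mem_Icc.2 zero_le_one)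
  rintro t ⟨ht, ht01⟩ y hy
  -- one of the closed sets contains points arbitrarily close to `t` on the right, hence `t`
  have hfreq : ∃ i, ∃ᶠ z in 𝓝[>] t, z ∈ F i := by
    by_contra! h
    simp only [← eventually_all] at h
    obtain ⟨z, hz, hz'⟩ := (h.and (Ioc_mem_nhdsGT ht01.2)).exists
    obtain ⟨i, hi⟩ := mem_iUnion.1 (hcov (show z ∈ Icc (0 : ℝ) 1 from
      ⟨ht01.1.trans hz'.1.le, hz'.2⟩))
    exact hz i hi
  obtain ⟨i, hi⟩ := hfreq
  have hti : t ∈ F i := (hF i).mem_of_frequently_of_tendsto hi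
    (tendsto_id.mono_left nhdsWithin_le_nhds)
  obtain ⟨z, hzF, hz⟩ := (hi.and_eventually
    (inter_mem (Ioc_mem_nhdsGT ht01.2) (Ioc_mem_nhdsGT hy))).exists
  refine ⟨z, ?_, hz.2⟩
  have ht' : t ∈ Icc (0 : ℝ) 1 := ⟨ht01.1, ht01.2.le⟩
  have hz' : z ∈ Icc (0 : ℝ) 1 := ⟨ht01.1.trans hz.1.1.le, hz.1.2⟩
  have h1 := hL i z ⟨hzF, hz'⟩ t ⟨hti, ht'⟩
  rw [abs_of_pos (sub_pos.2 hz.1.1)] at h1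
  have h2 := abs_sub_le (g z) (g t) (g 0)
  have ht2 : |g t - g 0| ≤ L * t := ht
  show |g z - g 0| ≤ L * z
  linarith

section WeakGradient

variable {d : ℕ} {Ω : Set (EuclideanSpace ℝ (Fin d))} {v : EuclideanSpace ℝ (Fin d) → ℝ} {L : ℝ≥0}

/-- A continuous function which is `L`-Lipschitz on each of finitely many closed sets is
`L`-Lipschitz on each convex set covered by them. -/
lemma lipschitzOnWith_of_finite_closed_cover {ι : Type*} [Finite ι]
    {F : ι → Set (EuclideanSpace ℝ (Fin d))} (hF : ∀ i, IsClosed (F i))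
    (hL : ∀ i, LipschitzOnWith L v (F i)) {S : Set (EuclideanSpace ℝ (Fin d))} (hS : Convex ℝ S)
    (hv : ContinuousOn v S) (hcov : S ⊆ ⋃ i, F i) : LipschitzOnWith L v S := by
  refine LipschitzOnWith.of_dist_le_mul fun x hx y hy => ?_
  have hmaps : MapsTo (AffineMap.lineMap (k := ℝ) y x) (Icc 0 1) S := fun t ht =>
    hS.lineMap_mem hy hx ht
  have hcont : Continuous (AffineMap.lineMap (k := ℝ) y x) := AffineMap.lineMap_continuous
  have h := abs_sub_le_of_finite_closed_cover (g := fun t => v (AffineMap.lineMap (k := ℝ) y x t))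
    (L := L * dist x y) (hv.comp hcont.continuousOn hmaps)
    (F := fun i => AffineMap.lineMap (k := ℝ) y x ⁻¹' F i) (fun i => (hF i).preimage hcont)
    (fun t ht => by
      have := hcov (hmaps ht)
      simpa using this)
    (fun i t ht t' ht' => by
      have := (hL i).dist_le_mul _ ht.1 _ ht'.1
      rw [dist_lineMap_lineMap, Real.dist_eq, Real.dist_eq, dist_comm y x] at this
      linarith)
  simpa [Real.dist_eq] using h

lemma real_inner_gradient_right (f : EuclideanSpace ℝ (Fin d) → ℝ) (x w : EuclideanSpace ℝ (Fin d)) :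
    inner ℝ w (gradient f x) = fderiv ℝ f x w := by
  rw [real_inner_comm, gradient, InnerProductSpace.toDual_symm_apply]

lemma norm_gradient (f : EuclideanSpace ℝ (Fin d) → ℝ) (x : EuclideanSpace ℝ (Fin d)) :
    ‖gradient f x‖ = ‖fderiv ℝ f x‖ := by
  rw [gradient, LinearIsometryEquiv.norm_map]

lemma measurable_gradient (f : EuclideanSpace ℝ (Fin d) → ℝ) : Measurable (gradient f) :=
  (InnerProductSpace.toDual ℝ (EuclideanSpace ℝ (Fin d))).symm.continuous.measurable.comp
    (measurable_fderiv ℝ f)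

lemma gradient_congr_of_eventuallyEq {f g : EuclideanSpace ℝ (Fin d) → ℝ}
    {x : EuclideanSpace ℝ (Fin d)} (h : f =ᶠ[𝓝 x] g) : gradient f x = gradient g x := by
  rw [gradient, gradient, h.fderiv_eq]

lemma integrable_smul_of_tsupport_subset {F : Type*} [NormedAddCommGroup F] [NormedSpace ℝ F]
    {g : EuclideanSpace ℝ (Fin d) → F} (hg : LocallyIntegrableOn g Ω volume)
    {φ : EuclideanSpace ℝ (Fin d) → ℝ} (hφ : Continuous φ) (hφc : HasCompactSupport φ)
    (hφΩ : tsupport φ ⊆ Ω) : Integrable (fun x => φ x • g x) volume := by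
  have h1 : IntegrableOn g (tsupport φ) volume := hg.integrableOn_compact_subset hφΩ hφc
  have h2 : IntegrableOn (fun x => φ x • g x) (tsupport φ) volume :=
    h1.continuousOn_smul hφ.continuousOn hφc
  refine (integrableOn_iff_integrable_of_support_subset fun x hx => ?_).1 h2
  refine subset_tsupport φ fun h => hx ?_
  simp [h]

/-- Integration by parts for a Lipschitz function and a test function. -/
lemma integral_smul_gradient_eq {C : ℝ≥0} {g : EuclideanSpace ℝ (Fin d) → ℝ}
    (hg : LipschitzWith C g) {φ : EuclideanSpace ℝ (Fin d) → ℝ} (hφ : ContDiff ℝ ∞ φ)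
    (hφc : HasCompactSupport φ) :
    ∫ x, g x • gradient φ x = - ∫ x, φ x • gradient g x := by
  obtain ⟨D, hD⟩ := hφ.lipschitzWith_of_hasCompactSupport hφc (by simp)
  have hφd : Differentiable ℝ φ := hφ.differentiable (by simp)
  have hgradφ : Continuous (gradient φ) :=
    (InnerProductSpace.toDual ℝ (EuclideanSpace ℝ (Fin d))).symm.continuous.comp
      (hφ.continuous_fderiv (by simp))
  have hgradφc : HasCompactSupport (gradient φ) :=
    (hφc.fderiv (𝕜 := ℝ)).comp_left (g := (InnerProductSpace.toDual ℝ _).symm) (map_zero _)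
  have hi1 : Integrable (fun x => g x • gradient φ x) volume :=
    (hg.continuous.smul hgradφ).integrable_of_hasCompactSupport hgradφc.smul_left
  have hgl : LocallyIntegrableOn (gradient g) univ volume := by
    rw [locallyIntegrableOn_univ]
    refine (locallyIntegrable_const (C : ℝ)).mono (measurable_gradient g).aestronglyMeasurable
      (Eventually.of_forall fun x => ?_)
    rw [norm_gradient, NNReal.norm_eq]
    exact norm_fderiv_le_of_lipschitz ℝ hg
  have hi2 : Integrable (fun x => φ x • gradient g x) volume :=
    integrable_smul_of_tsupport_subset hgl hφ.continuous hφc (subset_univ _)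
  refine ext_inner_left ℝ fun w => ?_
  rw [inner_neg_right, ← integral_inner hi1, ← integral_inner hi2]
  have h := hg.integral_lineDeriv_mul_eq (μ := volume) hD hφc w
  have h1 : ∀ x, lineDeriv ℝ φ x (-w) * g x = - inner ℝ w (g x • gradient φ x) := fun x => by
    rw [(hφd x).lineDeriv_eq_fderiv, inner_smul_right, real_inner_gradient_right, map_neg]
    ring
  have h2 : (fun x => lineDeriv ℝ g x w * φ x) =ᵐ[volume]
      fun x => inner ℝ w (φ x • gradient g x) := by
    filter_upwards [hg.ae_differentiableAt (μ := volume)] with x hx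
    rw [hx.lineDeriv_eq_fderiv, inner_smul_right, real_inner_gradient_right, mul_comm]
  rw [integral_congr_ae h2] at h
  simp only [h1] at h
  rw [integral_neg] at h
  linarith

lemma norm_gradient_le (hL : ∀ x ∈ Ω, ∃ U ∈ 𝓝 x, LipschitzOnWith L v U)
    {x : EuclideanSpace ℝ (Fin d)} (hx : x ∈ Ω) : ‖gradient v x‖ ≤ L := by
  obtain ⟨U, hU, hUL⟩ := hL x hx
  rw [norm_gradient]
  exact norm_fderiv_le_of_lipschitzOn ℝ hU hUL

lemma memLp_gradient (hΩ : IsOpen Ω) (hΩb : Bornology.IsBounded Ω)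
    (hL : ∀ x ∈ Ω, ∃ U ∈ 𝓝 x, LipschitzOnWith L v U) (p : ℝ≥0∞) :
    MemLp (gradient v) p (volume.restrict Ω) := by
  have : IsFiniteMeasure (volume.restrict Ω) := ⟨by
    rw [Measure.restrict_apply_univ]; exact hΩb.measure_lt_top⟩
  refine MemLp.of_bound (measurable_gradient v).aestronglyMeasurable L ?_
  filter_upwards [ae_restrict_mem hΩ.measurableSet] with x hx
  exact norm_gradient_le hL hx

/-- The pointwise gradient of a locally Lipschitz function is its weak gradient. -/
theorem hasWeakGradient_gradient (hΩ : IsOpen Ω) (hΩb : Bornology.IsBounded Ω)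
    (hL : ∀ x ∈ Ω, ∃ U ∈ 𝓝 x, LipschitzOnWith L v U) : HasWeakGradient Ω v (gradient v) := by
  have : IsFiniteMeasure (volume.restrict Ω) := ⟨by
    rw [Measure.restrict_apply_univ]; exact hΩb.measure_lt_top⟩
  have hcont : ContinuousOn v Ω := fun x hx => by
    obtain ⟨U, hU, hUL⟩ := hL x hx
    exact (hUL.continuousOn.continuousAt hU).continuousWithinAt
  refine ⟨hcont.locallyIntegrableOn hΩ.measurableSet,
    IntegrableOn.locallyIntegrableOn ((memLp_gradient hΩ hΩb hL 1).integrable le_rfl),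
    fun φ hφ hφc hφΩ => ?_⟩
  -- on a compact neighbourhood of the support of `φ`, the function `v` agrees with a globally
  -- Lipschitz function `g`
  obtain ⟨K, hK, hφK, hKΩ⟩ := exists_compact_between hφc hΩ hφΩ
  obtain ⟨C, hC⟩ := LocallyLipschitzOn.exists_lipschitzOnWith_of_compact (f := v) hK fun x hx => by
    obtain ⟨U, hU, hUL⟩ := hL x (hKΩ hx)
    exact ⟨L, U, mem_nhdsWithin_of_mem_nhds hU, hUL⟩
  obtain ⟨g, hg, hvg⟩ := hC.extend_real
  have hφ0 : ∀ x, x ∉ tsupport φ → φ x = 0 := fun x => image_eq_zero_of_notMem_tsupport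
  have hgφ0 : ∀ x, x ∉ tsupport φ → gradient φ x = 0 := fun x hx => by
    have : fderiv ℝ φ x = 0 := by
      by_contra h
      exact hx (support_fderiv_subset ℝ h)
    rw [gradient, this, map_zero]
  have h1 : ∀ x, v x • gradient φ x = g x • gradient φ x := fun x => by
    by_cases hx : x ∈ tsupport φ
    · rw [hvg (interior_subset (hφK hx))]
    · simp [hgφ0 x hx]
  have h2 : ∀ x, φ x • gradient v x = φ x • gradient g x := fun x => by
    by_cases hx : x ∈ tsupport φ
    · rw [gradient_congr_of_eventuallyEq (hvg.eventuallyEq_of_mem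
        (mem_interior_iff_mem_nhds.1 (hφK hx)))]
    · simp [hφ0 x hx]
  rw [setIntegral_eq_integral_of_forall_compl_eq_zero fun x hx => by
      rw [hgφ0 x fun h => hx (hφΩ h), smul_zero],
    setIntegral_eq_integral_of_forall_compl_eq_zero fun x hx => by
      rw [hφ0 x fun h => hx (hφΩ h), zero_smul]]
  simp only [h1, h2]
  exact integral_smul_gradient_eq hg hφ hφc

/-- Weak gradients are unique up to null sets. -/
lemma HasWeakGradient.ae_eq (hΩ : IsOpen Ω) {g g' : EuclideanSpace ℝ (Fin d) →
    EuclideanSpace ℝ (Fin d)} (hg : HasWeakGradient Ω v g) (hg' : HasWeakGradient Ω v g') :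
    g =ᵐ[volume.restrict Ω] g' := by
  have h := hΩ.ae_eq_zero_of_integral_contDiff_smul_eq_zero (hg.2.1.sub hg'.2.1)
    fun φ hφ hφc hφΩ => by
      have h1 := hg.2.2 φ hφ hφc hφΩ
      have h2 := hg'.2.2 φ hφ hφc hφΩ
      rw [h1, neg_inj] at h2
      have hz : ∀ x, x ∉ Ω → φ x = 0 := fun x hx =>
        image_eq_zero_of_notMem_tsupport fun h => hx (hφΩ h)
      rw [setIntegral_eq_integral_of_forall_compl_eq_zero fun x hx => by rw [hz x hx, zero_smul],
        setIntegral_eq_integral_of_forall_compl_eq_zero fun x hx => by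
          rw [hz x hx, zero_smul]] at h2
      simp only [Pi.sub_apply, smul_sub]
      rw [integral_sub (integrable_smul_of_tsupport_subset hg.2.1 hφ.continuous hφc hφΩ)
        (integrable_smul_of_tsupport_subset hg'.2.1 hφ.continuous hφc hφΩ), h2, sub_self]
  rw [EventuallyEq, ae_restrict_iff' hΩ.measurableSet]
  filter_upwards [h] with x hx hxΩ
  exact sub_eq_zero.1 (hx hxΩ)

end WeakGradient

/-! ### Lipschitz domains -/

section LipschitzDomain

variable {d : ℕ} {Ω A : Set (EuclideanSpace ℝ (Fin d))}

/-- The component of `y` orthogonal to the unit vector `e`. -/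
noncomputable def orthComp (e : EuclideanSpace ℝ (Fin d)) :
    EuclideanSpace ℝ (Fin d) →L[ℝ] EuclideanSpace ℝ (Fin d) :=
  ContinuousLinearMap.id ℝ _ - (innerSL ℝ e).smulRight e

lemma orthComp_apply (e y : EuclideanSpace ℝ (Fin d)) :
    orthComp e y = y - inner ℝ e y • e := by
  simp [orthComp]

variable {e : EuclideanSpace ℝ (Fin d)}

lemma inner_orthComp (he : ‖e‖ = 1) (y : EuclideanSpace ℝ (Fin d)) :
    inner ℝ e (orthComp e y) = 0 := by
  rw [orthComp_apply, inner_sub_right, inner_smul_right, real_inner_self_eq_norm_sq, he]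
  ring

lemma orthComp_add_smul (he : ‖e‖ = 1) (y : EuclideanSpace ℝ (Fin d)) (t : ℝ) :
    orthComp e (y + t • e) = orthComp e y := by
  rw [orthComp_apply, orthComp_apply, inner_add_right, inner_smul_right,
    real_inner_self_eq_norm_sq, he]
  module

lemma orthComp_orthComp (he : ‖e‖ = 1) (y : EuclideanSpace ℝ (Fin d)) :
    orthComp e (orthComp e y) = orthComp e y := by
  rw [orthComp_apply e (orthComp e y), inner_orthComp he]
  simp

lemma inner_add_smul (he : ‖e‖ = 1) (y : EuclideanSpace ℝ (Fin d)) (t : ℝ) :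
    inner ℝ e (y + t • e) = inner ℝ e y + t := by
  rw [inner_add_right, inner_smul_right, real_inner_self_eq_norm_sq, he]
  ring

/-- A Lipschitz domain lies on one side of its boundary. -/
lemma IsLipschitzDomain.interior_closure_subset (hΩ : IsLipschitzDomain Ω) :
    interior (closure Ω) ⊆ Ω := by
  intro x hx
  by_contra hxΩ
  have hfr : x ∈ frontier Ω := by
    rw [hΩ.1.frontier_eq]
    exact ⟨interior_subset hx, hxΩ⟩
  obtain ⟨V, e, L, f, hV, hxV, he, hf, hVf⟩ := hΩ.2.2 x hfr
  simp only [← orthComp_apply] at hVf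
  have hx1 : inner ℝ e x ≤ f (orthComp e x) := not_lt.1 fun h => hxΩ ((hVf x hxV).2 h)
  -- just below `x`, there are points which have a neighbourhood outside `Ω`
  have hcont : Continuous fun t : ℝ => x + (-t) • e := by fun_prop
  have hev : ∀ᶠ t : ℝ in 𝓝[>] 0, x + (-t) • e ∈ V ∩ interior (closure Ω) := by
    refine (hcont.tendsto' 0 x (by simp)).mono_left nhdsWithin_le_nhds
      ((hV.inter isOpen_interior).mem_nhds ⟨hxV, hx⟩)
  obtain ⟨t, ⟨htV, htΩ⟩, ht⟩ := (hev.and self_mem_nhdsWithin).exists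
  have ht0 : (0 : ℝ) < t := ht
  set U := V ∩ {y | inner ℝ e y < f (orthComp e y)} with hU
  have hUo : IsOpen U := hV.inter (isOpen_lt (by fun_prop)
    (hf.continuous.comp (orthComp e).continuous))
  have hmem : x + (-t) • e ∈ U := by
    refine ⟨htV, ?_⟩
    show inner ℝ e (x + (-t) • e) < f (orthComp e (x + (-t) • e))
    rw [inner_add_smul he, orthComp_add_smul he]
    linarith
  obtain ⟨y, hyU, hyΩ⟩ := mem_closure_iff.1 (interior_subset htΩ) U hUo hmem
  exact lt_asymm hyU.2 ((hVf y hyU.1).1 hyΩ)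

lemma inner_eq_of_mem_frontier (hA : IsOpen A) {V : Set (EuclideanSpace ℝ (Fin d))} (hV : IsOpen V)
    {f : EuclideanSpace ℝ (Fin d) → ℝ} (hf : Continuous f)
    (hVf : ∀ y ∈ V, y ∈ A ↔ f (orthComp e y) < inner ℝ e y) {y : EuclideanSpace ℝ (Fin d)}
    (hy : y ∈ frontier A) (hyV : y ∈ V) : f (orthComp e y) = inner ℝ e y := by
  rw [hA.frontier_eq] at hy
  refine le_antisymm (not_lt.1 fun h => ?_) (not_lt.1 fun h => hy.2 ((hVf y hyV).2 h))
  obtain ⟨z, ⟨hzV, hz⟩, hzA⟩ := mem_closure_iff.1 hy.1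
    (V ∩ {z | inner ℝ e z < f (orthComp e z)})
    (hV.inter (isOpen_lt (by fun_prop) (hf.comp (orthComp e).continuous))) ⟨hyV, h⟩
  exact lt_asymm hz ((hVf z hzV).1 hzA)

/-- The graph of a continuous function is a null set, since its vertical translates are disjoint. -/
lemma volume_graph_eq_zero (he : ‖e‖ = 1) {f : EuclideanSpace ℝ (Fin d) → ℝ} (hf : Continuous f) :
    volume {y | f (orthComp e y) = inner ℝ e y} = 0 := by
  refine Measure.addHaar_eq_zero_of_disjoint_translates volume
    (fun n : ℕ => (1 / ((n : ℝ) + 1)) • e) ?_ ?_ ?_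
  · refine (Metric.isBounded_closedBall (x := 0) (r := 1)).subset ?_
    rintro _ ⟨n, rfl⟩
    rw [mem_closedBall_zero_iff, norm_smul, he, mul_one, Real.norm_of_nonneg (by positivity),
      div_le_one (by positivity)]
    linarith [(Nat.cast_nonneg n : (0 : ℝ) ≤ n)]
  · intro m n hmn
    rw [Function.onFun, Set.disjoint_left]
    simp only [singleton_add, mem_image]
    rintro _ ⟨y, hy, rfl⟩ ⟨z, hz, hzy⟩
    have hy' : f (orthComp e y) = inner ℝ e y := hy
    have hz' : f (orthComp e z) = inner ℝ e z := hz
    rw [add_comm _ z, add_comm _ y] at hzy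
    have h1 := congrArg (fun x => f (orthComp e x)) hzy
    have h2 := congrArg (fun x => inner ℝ e x) hzy
    simp only [orthComp_add_smul he, inner_add_smul he] at h1 h2
    have h3 : 1 / ((n : ℝ) + 1) = 1 / ((m : ℝ) + 1) := by linarith
    rw [div_eq_div_iff (by positivity) (by positivity)] at h3
    exact hmn (by exact_mod_cast (by linarith : (m : ℝ) = n))
  · exact (isClosed_eq (hf.comp (orthComp e).continuous) (by fun_prop)).measurableSet

lemma IsLipschitzDomain.volume_frontier (hA : IsLipschitzDomain A) : volume (frontier A) = 0 := by
  refine measure_null_of_locally_null _ fun x hx => ?_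
  obtain ⟨V, e, L, f, hV, hxV, he, hf, hVf⟩ := hA.2.2 x hx
  simp only [← orthComp_apply] at hVf
  refine ⟨frontier A ∩ V, inter_mem self_mem_nhdsWithin (mem_nhdsWithin_of_mem_nhds
    (hV.mem_nhds hxV)), measure_mono_null (fun y hy => ?_) (volume_graph_eq_zero he hf.continuous)⟩
  exact inner_eq_of_mem_frontier hA.1 hV hf.continuous hVf hy.1 hy.2

/-- The part above the graph of a Lipschitz function of a cylinder whose top and bottom do not meet
the graph is connected: it is the continuous image of a convex set, since the vertical segments
between the graph and the top of the cylinder are parametrized by `(0, 1)`. -/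
lemma isPreconnected_cylinder_inter_epigraph (he : ‖e‖ = 1) {L : ℝ≥0}
    {f : EuclideanSpace ℝ (Fin d) → ℝ} (hf : LipschitzWith L f) {x : EuclideanSpace ℝ (Fin d)}
    (hfx : f (orthComp e x) = inner ℝ e x) {ρ : ℝ} (hρ : 0 < ρ) :
    IsPreconnected {y | (‖orthComp e y - orthComp e x‖ < ρ ∧
      |inner ℝ e y - inner ℝ e x| < (L + 1) * ρ) ∧ f (orthComp e y) < inner ℝ e y} := by
  have hL0 : (0 : ℝ) ≤ L := L.2
  set c : ℝ := inner ℝ e x with hc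
  set h : ℝ := c + (L + 1) * ρ with hh
  have hfz : ∀ z, ‖orthComp e z - orthComp e x‖ < ρ → |f (orthComp e z) - c| ≤ L * ρ := by
    intro z hz
    have := hf.dist_le_mul (orthComp e z) (orthComp e x)
    rw [Real.dist_eq, dist_eq_norm, hfx] at this
    exact this.trans (by gcongr)
  have himg : {y | (‖orthComp e y - orthComp e x‖ < ρ ∧
      |inner ℝ e y - c| < (L + 1) * ρ) ∧ f (orthComp e y) < inner ℝ e y} =
      (fun q : EuclideanSpace ℝ (Fin d) × ℝ =>
        orthComp e q.1 + ((1 - q.2) * f (orthComp e q.1) + q.2 * h) • e) ''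
      ((orthComp e ⁻¹' Metric.ball (orthComp e x) ρ) ×ˢ Ioo (0 : ℝ) 1) := by
    ext y
    constructor
    · rintro ⟨⟨hy1, hy2⟩, hlow⟩
      have htop : inner ℝ e y < h := by linarith [(abs_lt.1 hy2).2]
      have hpos : 0 < h - f (orthComp e y) := by linarith
      have hs : (1 - (inner ℝ e y - f (orthComp e y)) / (h - f (orthComp e y))) *
          f (orthComp e y) + (inner ℝ e y - f (orthComp e y)) / (h - f (orthComp e y)) * h =
          inner ℝ e y := by
        generalize f (orthComp e y) = φ at *
        generalize inner ℝ e y = η at *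
        field_simp
        ring
      have hball : orthComp e y ∈ Metric.ball (orthComp e x) ρ := mem_ball_iff_norm.2 hy1
      have hs01 : (inner ℝ e y - f (orthComp e y)) / (h - f (orthComp e y)) ∈ Ioo (0 : ℝ) 1 :=
        ⟨div_pos (sub_pos.2 hlow) hpos, (div_lt_one hpos).2 (by linarith)⟩
      refine ⟨(y, (inner ℝ e y - f (orthComp e y)) / (h - f (orthComp e y))),
        mk_mem_prod hball hs01, ?_⟩
      simp only [hs]
      rw [orthComp_apply, sub_add_cancel]
    · rintro ⟨⟨z, s⟩, ⟨hz, hs⟩, rfl⟩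
      have hz' : ‖orthComp e z - orthComp e x‖ < ρ := mem_ball_iff_norm.1 hz
      have hb := abs_le.1 (hfz z hz')
      have hs0 : 0 < s := hs.1
      have hs1 : s < 1 := hs.2
      simp only [mem_ofPred_eq, orthComp_add_smul he, orthComp_orthComp he, inner_add_smul he,
        inner_orthComp he, zero_add]
      generalize f (orthComp e z) = φ at *
      refine ⟨⟨hz', abs_lt.2 ⟨?_, ?_⟩⟩, ?_⟩
      · nlinarith
      · nlinarith
      · nlinarith
  rw [himg]
  refine IsPreconnected.image ?_ _ (Continuous.continuousOn ?_)
  · refine Convex.isPreconnected (Convex.prod ?_ (convex_Ioo 0 1))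
    exact (convex_ball _ ρ).linear_preimage (orthComp e).toLinearMap
  · have h1 : Continuous fun q : EuclideanSpace ℝ (Fin d) × ℝ => orthComp e q.1 :=
      (orthComp e).continuous.comp continuous_fst
    have h2 : Continuous fun q : EuclideanSpace ℝ (Fin d) × ℝ => f (orthComp e q.1) :=
      hf.continuous.comp h1
    exact h1.add ((((continuous_const.sub continuous_snd).mul h2).add
      (continuous_snd.mul continuous_const)).smul continuous_const)

/-- Each point of the closure of a Lipschitz domain has arbitrarily small neighbourhoods whose
intersection with the domain is connected. -/
lemma IsLipschitzDomain.exists_isPreconnected_inter (hΩ : IsLipschitzDomain Ω)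
    {x : EuclideanSpace ℝ (Fin d)} (hx : x ∈ closure Ω) {W : Set (EuclideanSpace ℝ (Fin d))}
    (hW : W ∈ 𝓝 x) : ∃ N ∈ 𝓝 x, N ⊆ W ∧ IsPreconnected (N ∩ Ω) := by
  by_cases hxΩ : x ∈ Ω
  · obtain ⟨ε, hε, hball⟩ := Metric.mem_nhds_iff.1 (inter_mem hW (hΩ.1.mem_nhds hxΩ))
    refine ⟨Metric.ball x ε, Metric.ball_mem_nhds x hε, hball.trans inter_subset_left, ?_⟩
    rw [inter_eq_left.2 (hball.trans inter_subset_right)]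
    exact (convex_ball x ε).isPreconnected
  have hfr : x ∈ frontier Ω := by
    rw [hΩ.1.frontier_eq]
    exact ⟨hx, hxΩ⟩
  obtain ⟨V, e, L, f, hV, hxV, he, hf, hVf⟩ := hΩ.2.2 x hfr
  simp only [← orthComp_apply] at hVf
  have hfx := inner_eq_of_mem_frontier hΩ.1 hV hf.continuous hVf hfr hxV
  obtain ⟨ε, hε, hball⟩ := Metric.mem_nhds_iff.1 (inter_mem hW (hV.mem_nhds hxV))
  -- the cylinder of radius `ρ` and height `2 (L + 1) ρ` is contained in the ball of radius `ε`
  set ρ : ℝ := ε / (L + 2) with hρ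
  have hL0 : (0 : ℝ) ≤ L := L.2
  have hρ0 : 0 < ρ := by positivity
  have hρε : (L + 2) * ρ = ε := by rw [hρ]; field_simp
  set N : Set (EuclideanSpace ℝ (Fin d)) := {y | ‖orthComp e y - orthComp e x‖ < ρ ∧
    |inner ℝ e y - inner ℝ e x| < (L + 1) * ρ} with hN
  have hNball : N ⊆ Metric.ball x ε := by
    rintro y ⟨hy1, hy2⟩
    have : y - x = (orthComp e y - orthComp e x) + (inner ℝ e y - inner ℝ e x) • e := by
      rw [orthComp_apply, orthComp_apply]; module
    rw [mem_ball_iff_norm, this]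
    refine (norm_add_le _ _).trans_lt ?_
    rw [norm_smul, he, mul_one, Real.norm_eq_abs]
    linarith
  have hNo : IsOpen N := by
    have h1 : Continuous fun y => ‖orthComp e y - orthComp e x‖ :=
      ((orthComp e).continuous.sub continuous_const).norm
    have h2 : Continuous fun y => |inner ℝ e y - inner ℝ e x| := by fun_prop
    exact (isOpen_lt h1 continuous_const).inter (isOpen_lt h2 continuous_const)
  have hxN : x ∈ N := by
    refine ⟨by simpa using hρ0, ?_⟩
    simp only [sub_self, abs_zero]
    positivity
  refine ⟨N, hNo.mem_nhds hxN, (hNball.trans hball).trans inter_subset_left, ?_⟩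
  have heq : N ∩ Ω = {y | (‖orthComp e y - orthComp e x‖ < ρ ∧
      |inner ℝ e y - inner ℝ e x| < (L + 1) * ρ) ∧ f (orthComp e y) < inner ℝ e y} := by
    ext y
    exact and_congr_right fun hy => hVf y (hball (hNball hy)).2
  rw [heq]
  exact isPreconnected_cylinder_inter_epigraph he hf hfx hρ0

lemma IsPreconnected.subset_interior_or_subset_compl_closure {X : Type*} [TopologicalSpace X]
    {S B : Set X} (hS : IsPreconnected S) (h : Disjoint S (frontier B)) :
    S ⊆ interior B ∨ S ⊆ (closure B)ᶜ := by
  refine IsPreconnected.subset_or_subset isOpen_interior isClosed_closure.isOpen_compl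
    (disjoint_compl_right.mono_left interior_subset_closure) (fun x hx => ?_) hS
  by_cases hxB : x ∈ closure B
  · exact Or.inl (by_contra fun hxi => Set.disjoint_left.1 h hx ⟨hxB, hxi⟩)
  · exact Or.inr hxB

/-- Where a subset `A` of a Lipschitz domain and its complement in the domain meet, possibly only at
the boundary of the domain, the interface in the interior of the domain is arbitrarily close. -/
lemma IsLipschitzDomain.mem_closure_frontier_inter (hΩ : IsLipschitzDomain Ω) (hAΩ : A ⊆ Ω)
    {x : EuclideanSpace ℝ (Fin d)} (hxA : x ∈ closure A) (hxB : x ∈ closure (Ω \ A)) :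
    x ∈ closure (frontier A ∩ Ω) := by
  rw [mem_closure_iff_nhds]
  intro W hW
  obtain ⟨N, hN, hNW, hNΩ⟩ := hΩ.exists_isPreconnected_inter (closure_mono hAΩ hxA) hW
  obtain ⟨y, hyN, hyA⟩ := mem_closure_iff_nhds.1 hxA N hN
  obtain ⟨z, hzN, hzΩ, hzA⟩ := mem_closure_iff_nhds.1 hxB N hN
  by_contra h
  have hdisj : Disjoint (N ∩ Ω) (frontier A) := Set.disjoint_left.2 fun w hw hwA =>
    h ⟨w, hNW hw.1, hwA, hw.2⟩
  rcases IsPreconnected.subset_interior_or_subset_compl_closure hNΩ hdisj with hs | hs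
  · exact hzA (interior_subset (hs ⟨hzN, hzΩ⟩))
  · exact hs ⟨hyN, hAΩ hyA⟩ (subset_closure hyA)

end LipschitzDomain

/-! ### Conformity of the finite element space -/

section Conforming

variable {d r : ℕ} {Ω A : Set (EuclideanSpace ℝ (Fin d))}
  {T : Geometry.SimplicialComplex ℝ (EuclideanSpace ℝ (Fin d))}
  {s : Finset (EuclideanSpace ℝ (Fin d))} {v w f : EuclideanSpace ℝ (Fin d) → ℝ} {L : ℝ≥0}

lemma exists_baryCoord_lipschitz (s : Finset (EuclideanSpace ℝ (Fin d))) :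
    ∃ Λ : ℝ, 0 ≤ Λ ∧ ∀ p ∈ s, ∀ x y, |baryCoord s p x - baryCoord s p y| ≤ Λ * dist x y := by
  set l := fun p => LinearMap.toContinuousLinearMap (baryCoord s p).linear with hl
  refine ⟨∑ p ∈ s, ‖l p‖, Finset.sum_nonneg fun _ _ => norm_nonneg _, fun p hp x y => ?_⟩
  have h1 : baryCoord s p x - baryCoord s p y = l p (x - y) := by
    simp only [hl, LinearMap.coe_toContinuousLinearMap']
    rw [← vsub_eq_sub x y, AffineMap.linearMap_vsub, vsub_eq_sub]
  rw [h1, ← Real.norm_eq_abs, dist_eq_norm]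
  refine ((l p).le_opNorm _).trans ?_
  gcongr
  exact Finset.single_le_sum (f := fun p => ‖l p‖) (fun _ _ => norm_nonneg _) hp

lemma exists_lipschitzOnWith_of_mem_feSpace (hr : 1 ≤ r) (hΩb : Bornology.IsBounded Ω)
    (hT : IsSimplicialMesh Ω T) (hv : v ∈ feSpace Ω T r) :
    ∃ L : ℝ≥0, ∀ s ∈ meshElements T, LipschitzOnWith L v (simplexHull s) := by
  obtain ⟨B, hB⟩ := hΩb.isCompact_closure.exists_bound_of_continuousOn hv.1
  obtain ⟨C, hC0, hC⟩ := exists_localInterp_bound d r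
  choose Λ hΛ0 hΛ using exists_baryCoord_lipschitz (d := d)
  have hB' : ∀ x ∈ closure Ω, |v x| ≤ max B 0 := fun x hx => (hB x hx).trans (le_max_left _ _)
  set M : ℝ := C * max B 0 * ∑ s ∈ hT.finite_meshElements.toFinset, Λ s with hM
  have hS0 : 0 ≤ C * max B 0 := mul_nonneg hC0 (le_max_right _ _)
  refine ⟨M.toNNReal, fun s hs => LipschitzOnWith.of_dist_le_mul fun x hx y hy => ?_⟩
  have hsn := isNondegenerateSimplex_of_mem_meshElements hs
  have h := (hC s hsn v (max B 0) (le_max_right _ _)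
    (fun z hz => hB' z (hT.lagrangeNodes_subset hr hs hz)) x hx).2 y hy (Λ s * dist x y)
    (mul_nonneg (hΛ0 s) dist_nonneg) (fun p hp => hΛ s p hp x y)
  rw [← (isFEInterpolant_self hv).eq_localInterp hr hs hx,
    ← (isFEInterpolant_self hv).eq_localInterp hr hs hy] at h
  have h1 : Λ s ≤ ∑ s ∈ hT.finite_meshElements.toFinset, Λ s :=
    Finset.single_le_sum (fun s _ => hΛ0 s) (hT.finite_meshElements.mem_toFinset.2 hs)
  rw [Real.dist_eq]
  refine h.trans ?_
  rw [← mul_assoc]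
  refine mul_le_mul_of_nonneg_right ?_ dist_nonneg
  exact (mul_le_mul_of_nonneg_left h1 hS0).trans (Real.le_coe_toNNReal M)

/-- An elementwise `L`-Lipschitz finite element function is locally `L`-Lipschitz. -/
lemma exists_nhds_lipschitzOnWith (hΩ : IsOpen Ω) (hT : IsSimplicialMesh Ω T)
    (hv : v ∈ feSpace Ω T r) (hL : ∀ s ∈ meshElements T, LipschitzOnWith L v (simplexHull s))
    {x : EuclideanSpace ℝ (Fin d)} (hx : x ∈ Ω) : ∃ U ∈ 𝓝 x, LipschitzOnWith L v U := by
  obtain ⟨ε, hε, hball⟩ := Metric.mem_nhds_iff.1 (hΩ.mem_nhds hx)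
  have : Finite (meshElements T) := hT.finite_meshElements
  have hsub := hball.trans subset_closure
  refine ⟨Metric.ball x ε, Metric.ball_mem_nhds x hε, lipschitzOnWith_of_finite_closed_cover
    (F := fun s : meshElements T => simplexHull s.1) (fun s => (isCompact_simplexHull s.1).isClosed)
    (fun s => hL s.1 s.2) (convex_ball x ε) (hv.1.mono hsub) ?_⟩
  rwa [← biUnion_eq_iUnion (meshElements T) fun s _ => simplexHull s, hT.2.2]

lemma memH1_of_mem_feSpace (hr : 1 ≤ r) (hΩ : IsOpen Ω) (hΩb : Bornology.IsBounded Ω)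
    (hT : IsSimplicialMesh Ω T) (hv : v ∈ feSpace Ω T r) : MemH1 Ω v := by
  obtain ⟨L, hL⟩ := exists_lipschitzOnWith_of_mem_feSpace hr hΩb hT hv
  have hloc := fun x hx => exists_nhds_lipschitzOnWith (x := x) hΩ hT hv hL hx
  have : IsFiniteMeasure (volume.restrict Ω) := ⟨by
    rw [Measure.restrict_apply_univ]; exact hΩb.measure_lt_top⟩
  obtain ⟨B, hB⟩ := hΩb.isCompact_closure.exists_bound_of_continuousOn hv.1
  refine ⟨MemLp.of_bound ((hv.1.mono subset_closure).aestronglyMeasurable hΩ.measurableSet) B ?_,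
    gradient v, hasWeakGradient_gradient hΩ hΩb hloc, memLp_gradient hΩ hΩb hloc 2⟩
  filter_upwards [ae_restrict_mem hΩ.measurableSet] with x hx
  exact hB x (subset_closure hx)

/-! ### Interpolants of characteristic functions -/

lemma IsIndicatorExtension.abs_le_one (hf : IsIndicatorExtension Ω A f)
    {x : EuclideanSpace ℝ (Fin d)} (hx : x ∈ closure Ω) : |f x| ≤ 1 := by
  rcases hf x hx with ⟨h, -⟩ | ⟨h, -⟩ <;> simp [h]

lemma IsSimplicialMesh.interior_simplexHull_subset (hΩ : IsLipschitzDomain Ω)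
    (hT : IsSimplicialMesh Ω T) (hs : s ∈ meshElements T) : interior (simplexHull s) ⊆ Ω :=
  (interior_mono (hT.simplexHull_subset hs)).trans hΩ.interior_closure_subset

/-- Almost every point of `Ω` is in the interior of an element. -/
lemma IsSimplicialMesh.ae_mem_interior (hT : IsSimplicialMesh Ω T) :
    ∀ᵐ x, x ∈ Ω → ∃ s ∈ meshElements T, x ∈ interior (simplexHull s) := by
  have h : ∀ᵐ x : EuclideanSpace ℝ (Fin d), ∀ s ∈ meshElements T,
      x ∉ frontier (simplexHull s) := by
    rw [ae_ball_iff hT.finite_meshElements.countable]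
    intro s _
    exact measure_eq_zero_iff_ae_notMem.1 ((convex_simplexHull s).addHaar_frontier volume)
  filter_upwards [h] with x hx hxΩ
  obtain ⟨s, hs, hxs⟩ := hT.exists_mem_simplexHull (subset_closure hxΩ)
  refine ⟨s, hs, by_contra fun hxi => hx s hs ?_⟩
  rw [(isCompact_simplexHull s).isClosed.frontier_eq]
  exact ⟨hxs, hxi⟩

lemma isOpen_interfaceNhd (hΩ : IsOpen Ω) (A : Set (EuclideanSpace ℝ (Fin d))) (δ : ℝ) :
    IsOpen (interfaceNhd Ω A δ) :=
  hΩ.inter Metric.isOpen_thickening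

lemma closure_interfaceNhd_subset (Ω A : Set (EuclideanSpace ℝ (Fin d))) (δ : ℝ) :
    closure (interfaceNhd Ω A δ) ⊆ Metric.cthickening δ (frontier A ∩ Ω) :=
  closure_minimal (inter_subset_right.trans (Metric.thickening_subset_cthickening _ _))
    Metric.isClosed_cthickening

lemma closure_frontier_inter_subset {δ : ℝ} (hδ : 0 < δ) :
    closure (frontier A ∩ Ω) ⊆ closure (interfaceNhd Ω A δ) :=
  closure_mono fun _ hx => ⟨hx.2, Metric.self_subset_thickening hδ _ hx⟩

/-- An element of diameter at most `δ` which meets the closure of the interface is contained in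
`closure U_δ`. -/
lemma simplexHull_subset_closure_interfaceNhd (hΩ : IsLipschitzDomain Ω)
    (hT : IsSimplicialMesh Ω T) (hs : s ∈ meshElements T) {δ : ℝ}
    (hδ0 : 0 < δ) (hδ : Metric.diam (simplexHull s) ≤ δ) {x : EuclideanSpace ℝ (Fin d)} (hx : x ∈ simplexHull s)
    (hxA : x ∈ closure (frontier A ∩ Ω)) : simplexHull s ⊆ closure (interfaceNhd Ω A δ) := by
  have hsn := isNondegenerateSimplex_of_mem_meshElements hs
  rw [← closure_interior_simplexHull hsn]
  refine closure_minimal (fun y hy => ?_) isClosed_closure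
  have hys := interior_subset hy
  rcases eq_or_ne x y with rfl | hxy
  · exact closure_frontier_inter_subset hδ0 hxA
  -- approximate `y` by points in the interior of the element which are closer to `x`
  have hcont : Continuous fun t : ℝ => AffineMap.lineMap (k := ℝ) y x t :=
    AffineMap.lineMap_continuous
  have hlim : Tendsto (fun t : ℝ => AffineMap.lineMap (k := ℝ) y x t) (𝓝[>] 0) (𝓝 y) :=
    (hcont.tendsto' 0 y (by simp)).mono_left nhdsWithin_le_nhds
  refine mem_closure_of_tendsto hlim ?_
  filter_upwards [hlim (isOpen_interior.mem_nhds hy), Ioo_mem_nhdsGT (zero_lt_one' ℝ)] with t ht ht01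
  refine ⟨hT.interior_simplexHull_subset hΩ hs ht, ?_⟩
  have hxy' : 0 < dist y x := dist_pos.2 hxy.symm
  have hd : dist (AffineMap.lineMap (k := ℝ) y x t) x < δ := by
    rw [dist_lineMap_right, Real.norm_of_nonneg (by linarith [ht01.2])]
    have := (Metric.dist_le_diam_of_mem (isCompact_simplexHull s).isBounded hys hx).trans hδ
    nlinarith [ht01.1]
  obtain ⟨z, hz, hxz⟩ := Metric.mem_closure_iff.1 hxA _ (sub_pos.2 hd)
  refine Metric.mem_thickening_iff.2 ⟨z, hz, ?_⟩
  linarith [dist_triangle (AffineMap.lineMap (k := ℝ) y x t) x z]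

/-- Away from the interface, `A` and its pointwise extensions are trivial on each element. This also
concerns nodes on `∂Ω`: if the nodal value there differs from the value in the interior of the
element, then the interface in `Ω` comes arbitrarily close. -/
lemma IsIndicatorExtension.eq_const_of_disjoint (hΩ : IsLipschitzDomain Ω)
    (hT : IsSimplicialMesh Ω T) (hr : 1 ≤ r) (hAΩ : A ⊆ Ω) (hf : IsIndicatorExtension Ω A f)
    (hs : s ∈ meshElements T) (hdisj : Disjoint (simplexHull s) (closure (frontier A ∩ Ω))) :
    ∃ c : ℝ, (∀ x ∈ lagrangeNodes r s, f x = c) ∧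
      ∀ x ∈ interior (simplexHull s), A.indicator (fun _ => (1 : ℝ)) x = c := by
  have hsn := isNondegenerateSimplex_of_mem_meshElements hs
  have hint := hT.interior_simplexHull_subset hΩ hs
  have hpre : IsPreconnected (interior (simplexHull s)) :=
    (convex_simplexHull s).interior.isPreconnected
  have hfr : Disjoint (interior (simplexHull s)) (frontier A) := Set.disjoint_left.2
    fun x hx hxA => Set.disjoint_left.1 hdisj (interior_subset hx) (subset_closure ⟨hxA, hint hx⟩)
  have hnode : ∀ x ∈ lagrangeNodes r s, x ∈ closure (interior (simplexHull s)) ∧ x ∈ closure Ω ∧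
      x ∉ closure (frontier A ∩ Ω) := fun x hx => by
    have := lagrangeNodes_subset_simplexHull hr s hx
    exact ⟨by rwa [closure_interior_simplexHull hsn], hT.simplexHull_subset hs this,
      Set.disjoint_left.1 hdisj this⟩
  rcases IsPreconnected.subset_interior_or_subset_compl_closure hpre hfr with hA | hA
  · refine ⟨1, fun x hx => ?_, fun x hx => indicator_of_mem (interior_subset (hA hx)) _⟩
    obtain ⟨h1, h2, h3⟩ := hnode x hx
    rcases hf x h2 with ⟨h, -⟩ | ⟨-, h⟩
    · exact h
    · exact absurd (hΩ.mem_closure_frontier_inter hAΩ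
        (closure_mono (hA.trans interior_subset) h1)
        (closure_mono (sdiff_subset_sdiff_right subset_closure) h)) h3
  · refine ⟨0, fun x hx => ?_, fun x hx =>
      indicator_of_notMem (fun h => hA hx (subset_closure h)) _⟩
    obtain ⟨h1, h2, h3⟩ := hnode x hx
    rcases hf x h2 with ⟨-, h⟩ | ⟨h, -⟩
    · have hsub : interior (simplexHull s) ⊆ Ω \ A :=
        fun y hy => ⟨hint hy, fun h => hA hy (subset_closure h)⟩
      exact absurd (hΩ.mem_closure_frontier_inter hAΩ h (closure_mono hsub h1)) h3
    · exact h

/-- Outside `closure U_δ`, the interpolant of an extension of `χ_A` agrees with `χ_A` and has zero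
gradient. -/
lemma IsFEInterpolant.ae_eq_indicator (hΩ : IsLipschitzDomain Ω) (hT : IsSimplicialMesh Ω T)
    (hr : 1 ≤ r) (hAΩ : A ⊆ Ω) (hf : IsIndicatorExtension Ω A f) (hv : IsFEInterpolant Ω T r f v)
    {δ : ℝ} (hδ0 : 0 < δ) (hδ : ∀ s ∈ meshElements T, Metric.diam (simplexHull s) ≤ δ) :
    ∀ᵐ x, x ∈ Ω → x ∉ closure (interfaceNhd Ω A δ) →
      v x = A.indicator (fun _ => (1 : ℝ)) x ∧ gradient v x = 0 := by
  filter_upwards [hT.ae_mem_interior] with x hx hxΩ hxU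
  obtain ⟨s, hs, hxs⟩ := hx hxΩ
  have hdisj : Disjoint (simplexHull s) (closure (frontier A ∩ Ω)) := Set.disjoint_left.2
    fun y hy hyA => hxU (simplexHull_subset_closure_interfaceNhd hΩ hT hs hδ0 (hδ s hs) hy hyA
      (interior_subset hxs))
  obtain ⟨c, hc, hcA⟩ := hf.eq_const_of_disjoint hΩ hT hr hAΩ hs hdisj
  have hvc : ∀ y ∈ simplexHull s, v y = c := fun y hy => hv.eq_const hr hs hc hy
  refine ⟨by rw [hvc x (interior_subset hxs), hcA x hxs], ?_⟩
  have : v =ᶠ[𝓝 x] fun _ => c := by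
    filter_upwards [mem_interior_iff_mem_nhds.1 hxs] with y hy using hvc y hy
  rw [gradient_congr_of_eventuallyEq this, gradient, fderiv_const_apply, map_zero]

lemma frontier_diff_frontier_interfaceNhd (hΩ : IsOpen Ω) {δ : ℝ} {x : EuclideanSpace ℝ (Fin d)}
    (hx : x ∈ frontier Ω \ frontier (interfaceNhd Ω A δ)) : x ∉ closure (interfaceNhd Ω A δ) := by
  intro h
  refine hx.2 ?_
  rw [(isOpen_interfaceNhd hΩ A δ).frontier_eq]
  rw [hΩ.frontier_eq] at hx
  exact ⟨h, fun h' => hx.1.2 h'.1⟩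

lemma tendsto_setLAverage_zero {S : Set (EuclideanSpace ℝ (Fin d))} (hS : MeasurableSet S)
    {x : EuclideanSpace ℝ (Fin d)} {N : Set (EuclideanSpace ℝ (Fin d))} (hN : N ∈ 𝓝 x)
    {u : EuclideanSpace ℝ (Fin d) → ℝ} {c : ℝ} (hu : ∀ᵐ y, y ∈ N ∩ S → u y = c) :
    Tendsto (fun ρ : ℝ => ⨍⁻ y in Metric.ball x ρ ∩ S, ‖u y - c‖ₑ ∂volume) (𝓝[>] 0) (𝓝 0) := by
  obtain ⟨ε, hε, hball⟩ := Metric.mem_nhds_iff.1 hN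
  refine tendsto_const_nhds.congr' ?_
  filter_upwards [Ioo_mem_nhdsGT hε] with ρ hρ
  rw [setLAverage_congr_fun_ae (g := fun _ => 0) (Metric.isOpen_ball.measurableSet.inter hS),
    laverage_zero]
  filter_upwards [hu] with y hy hyS
  rw [hy ⟨hball (Metric.ball_subset_ball hρ.2.le hyS.1), hyS.2⟩]
  simp

/-- Away from `∂U_δ`, both `χ_A` and the interpolant are constant near a boundary point of `Ω`. -/
lemma IsFEInterpolant.exists_hasTraceOn (hΩ : IsLipschitzDomain Ω) (hT : IsSimplicialMesh Ω T)
    (hr : 1 ≤ r) (hAΩ : A ⊆ Ω) (hf : IsIndicatorExtension Ω A f) (hv : IsFEInterpolant Ω T r f v)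
    {δ : ℝ} (hδ0 : 0 < δ) (hδ : ∀ s ∈ meshElements T, Metric.diam (simplexHull s) ≤ δ)
    {Γ : Set (EuclideanSpace ℝ (Fin d))} (hΓ : Γ ⊆ frontier Ω \ frontier (interfaceNhd Ω A δ)) :
    ∃ t, HasTraceOn Ω Γ (A.indicator fun _ => (1 : ℝ)) t ∧ HasTraceOn Ω Γ v t := by
  have key : ∀ x ∈ Γ, ∃ c : ℝ, ∃ N ∈ 𝓝 x, N ∩ closure (interfaceNhd Ω A δ) = ∅ ∧
      ∀ y ∈ N ∩ Ω, A.indicator (fun _ => (1 : ℝ)) y = c := by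
    intro x hx
    have hxU := frontier_diff_frontier_interfaceNhd hΩ.1 (hΓ hx)
    have hxA : x ∉ closure (frontier A ∩ Ω) := fun h => hxU (closure_frontier_inter_subset hδ0 h)
    by_cases h : x ∈ closure A
    · have h' : x ∉ closure (Ω \ A) := fun h' => hxA (hΩ.mem_closure_frontier_inter hAΩ h h')
      refine ⟨1, (closure (Ω \ A))ᶜ ∩ (closure (interfaceNhd Ω A δ))ᶜ,
        inter_mem (isClosed_closure.isOpen_compl.mem_nhds h')
          (isClosed_closure.isOpen_compl.mem_nhds hxU), ?_, fun y hy => ?_⟩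
      · rw [inter_assoc, compl_inter_self, inter_empty]
      · exact indicator_of_mem (by_contra fun hyA => hy.1.1 (subset_closure ⟨hy.2, hyA⟩)) _
    · refine ⟨0, (closure A)ᶜ ∩ (closure (interfaceNhd Ω A δ))ᶜ,
        inter_mem (isClosed_closure.isOpen_compl.mem_nhds h)
          (isClosed_closure.isOpen_compl.mem_nhds hxU), ?_, fun y hy => ?_⟩
      · rw [inter_assoc, compl_inter_self, inter_empty]
      · exact indicator_of_notMem (fun hyA => hy.1.1 (subset_closure hyA)) _
  choose! t N hN hNU ht using key
  refine ⟨t, Eventually.of_forall fun x hx => tendsto_setLAverage_zero hΩ.1.measurableSet (hN x hx)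
    (Eventually.of_forall (ht x hx)), Eventually.of_forall fun x hx =>
    tendsto_setLAverage_zero hΩ.1.measurableSet (hN x hx) ?_⟩
  filter_upwards [hv.ae_eq_indicator hΩ hT hr hAΩ hf hδ0 hδ] with y hy hyN
  rw [(hy hyN.2 fun hyU => ?_).1, ht x hx y hyN]
  have : y ∈ N x ∩ closure (interfaceNhd Ω A δ) := ⟨hyN.1, hyU⟩
  rwa [hNU x hx] at this

end Conforming

/-! ### Admissibility of interpolation -/

section Admissible

variable {d r : ℕ} {Ω A : Set (EuclideanSpace ℝ (Fin d))} {H : Set ℝ}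
  {T : ℝ → Geometry.SimplicialComplex ℝ (EuclideanSpace ℝ (Fin d))}
  {f : EuclideanSpace ℝ (Fin d) → ℝ} {v : ℝ → EuclideanSpace ℝ (Fin d) → ℝ}

/-- On a regular and quasi-uniform family of meshes, the gradients of the barycentric coordinates
are of order `1 / h`. -/
lemma exists_mul_baryCoord_sub_le (hreg : IsRegularMeshFamily H T)
    (hqu : IsQuasiUniformMeshFamily H T) : ∃ Λ : ℝ, 0 ≤ Λ ∧ ∀ h ∈ H, ∀ s ∈ meshElements (T h),
      ∀ p ∈ s, ∀ x y, |baryCoord s p x - baryCoord s p y| * h ≤ Λ * dist x y := by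
  obtain ⟨σ, hσ⟩ := hreg
  obtain ⟨τ, hτ, hτh⟩ := hqu
  refine ⟨max σ 0 / τ, by positivity, fun h hh s hs p hp x y => ?_⟩
  have h1 := baryCoord_sub_mul_inballDiam_le (isNondegenerateSimplex_of_mem_meshElements hs) hp x y
  have h2 : 0 ≤ inballDiam s :=
    mul_nonneg zero_le_two (Real.sSup_nonneg fun ρ hρ => hρ.1)
  have h3 : τ * h ≤ max σ 0 * inballDiam s := (hτh h hh s hs).trans ((hσ h hh s hs).trans
    (mul_le_mul_of_nonneg_right (le_max_left _ _) h2))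
  rw [div_mul_eq_mul_div, le_div_iff₀ hτ]
  calc |baryCoord s p x - baryCoord s p y| * h * τ
      = |baryCoord s p x - baryCoord s p y| * (τ * h) := by ring
    _ ≤ |baryCoord s p x - baryCoord s p y| * (max σ 0 * inballDiam s) := by gcongr
    _ = max σ 0 * (|baryCoord s p x - baryCoord s p y| * inballDiam s) := by ring
    _ ≤ max σ 0 * dist x y := by gcongr

/-- The measure of the neighbourhoods of the interface tends to zero, since the boundary of a
Lipschitz domain is a null set. -/
lemma tendsto_volume_cthickening_frontier (hΩb : Bornology.IsBounded Ω) (hA : IsLipschitzDomain A) :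
    Tendsto (fun δ => volume (Metric.cthickening δ (frontier A ∩ Ω))) (𝓝 0) (𝓝 0) := by
  have h := tendsto_measure_cthickening (μ := (volume : Measure (EuclideanSpace ℝ (Fin d))))
    (s := frontier A ∩ Ω)
    ⟨1, one_pos, ((hΩb.subset inter_subset_right).cthickening.measure_lt_top).ne⟩
  rwa [measure_mono_null (closure_minimal inter_subset_left isClosed_frontier)
    hA.volume_frontier] at h

lemma HasMeshSize.diam_le {T : Geometry.SimplicialComplex ℝ (EuclideanSpace ℝ (Fin d))} {h : ℝ}
    (hT : HasMeshSize T h) {s : Finset (EuclideanSpace ℝ (Fin d))} (hs : s ∈ meshElements T) :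
    Metric.diam (simplexHull s) ≤ h :=
  hT.2 ⟨s, hs, rfl⟩

/-- Interpolants of extensions of characteristic functions are bounded, and their Lipschitz
constants on the elements are controlled by those of the barycentric coordinates. -/
lemma exists_interpolant_bound (d r : ℕ) : ∃ C : ℝ, 0 ≤ C ∧
    ∀ (Ω A : Set (EuclideanSpace ℝ (Fin d)))
      (T : Geometry.SimplicialComplex ℝ (EuclideanSpace ℝ (Fin d)))
      (f v : EuclideanSpace ℝ (Fin d) → ℝ), 1 ≤ r → IsSimplicialMesh Ω T →
      IsIndicatorExtension Ω A f → IsFEInterpolant Ω T r f v →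
      (∀ x ∈ closure Ω, |v x| ≤ C) ∧
      ∀ s ∈ meshElements T, ∀ Λ : ℝ, 0 ≤ Λ →
        (∀ p ∈ s, ∀ x y, |baryCoord s p x - baryCoord s p y| ≤ Λ * dist x y) →
        LipschitzOnWith (C * Λ).toNNReal v (simplexHull s) := by
  obtain ⟨C, hC0, hC⟩ := exists_localInterp_bound d r
  refine ⟨C, hC0, fun Ω A T f v hr hT hf hv => ?_⟩
  have hb : ∀ s ∈ meshElements T, ∀ x ∈ lagrangeNodes r s, |f x| ≤ 1 := fun s hs x hx =>
    hf.abs_le_one (hT.lagrangeNodes_subset hr hs hx)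
  constructor
  · intro x hx
    obtain ⟨s, hs, hxs⟩ := hT.exists_mem_simplexHull hx
    rw [hv.eq_localInterp hr hs hxs]
    simpa using (hC s (isNondegenerateSimplex_of_mem_meshElements hs) f 1 zero_le_one (hb s hs)
      x hxs).1
  · intro s hs Λ hΛ hbary
    refine LipschitzOnWith.of_dist_le_mul fun x hx y hy => ?_
    have := (hC s (isNondegenerateSimplex_of_mem_meshElements hs) f 1 zero_le_one (hb s hs) x hx).2
      y hy (Λ * dist x y) (by positivity) fun p hp => hbary p hp x y
    rw [Real.dist_eq, hv.eq_localInterp hr hs hx, hv.eq_localInterp hr hs hy,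
      Real.coe_toNNReal _ (by positivity)]
    linarith

/-- The four admissibility conditions for the interpolants of an extension of `χ_A`. -/
theorem admissibleConditions_of_isFEInterpolant (hΩ : IsLipschitzDomain Ω)
    (hΩb : Bornology.IsBounded Ω) (hr : 1 ≤ r) (hH : H ⊆ Ioi 0)
    (hT : ∀ h ∈ H, IsSimplicialMesh Ω (T h)) (hsize : ∀ h ∈ H, HasMeshSize (T h) h)
    (hreg : IsRegularMeshFamily H T) (hqu : IsQuasiUniformMeshFamily H T)
    (hA : IsLipschitzDomain A) (hAΩ : A ⊆ Ω) (hf : IsIndicatorExtension Ω A f)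
    (hv : ∀ h ∈ H, IsFEInterpolant Ω (T h) r f (v h)) : AdmissibleConditions Ω H A v := by
  have hdiam : ∀ h ∈ H, ∀ s ∈ meshElements (T h), Metric.diam (simplexHull s) ≤ h :=
    fun h hh s hs => (hsize h hh).diam_le hs
  have hae := fun h hh =>
    (hv h hh).ae_eq_indicator hΩ (hT h hh) hr hAΩ hf (hH hh) (hdiam h hh)
  obtain ⟨C, hC0, hC⟩ := exists_interpolant_bound d r
  obtain ⟨Λ, hΛ0, hΛ⟩ := exists_mul_baryCoord_sub_le hreg hqu
  have hgrad : ∀ h ∈ H, ∀ x ∈ Ω, ∃ U ∈ 𝓝 x, LipschitzOnWith (C * (Λ / h)).toNNReal (v h) U := by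
    intro h hh x hx
    have hh0 : 0 < h := hH hh
    refine exists_nhds_lipschitzOnWith hΩ.1 (hT h hh) (hv h hh).1 (fun s hs => ?_) hx
    refine (hC Ω A (T h) f (v h) hr (hT h hh) hf (hv h hh)).2 s hs (Λ / h) (by positivity)
      fun p hp x y => ?_
    rw [div_mul_eq_mul_div, le_div_iff₀ hh0]
    exact hΛ h hh s hs p hp x y
  refine ⟨?_, fun h hh => ?_, ?_, fun h hh Γ hΓ _ => ?_⟩
  · set S := frontier A ∩ Ω with hS
    have hlim : Tendsto (fun δ => ‖C + 1‖ₑ * volume (Metric.cthickening δ S) ^ (1 / (2 : ℝ)))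
        (𝓝[H] 0) (𝓝 0) := by
      have h1 := (tendsto_volume_cthickening_frontier hΩb hA).mono_left
        (nhdsWithin_le_nhds (s := H))
      have h2 := (ENNReal.continuous_rpow_const (y := 1 / (2 : ℝ))).tendsto 0 |>.comp h1
      rw [ENNReal.zero_rpow_of_pos (by norm_num)] at h2
      have h3 := ENNReal.Tendsto.const_mul (a := ‖C + 1‖ₑ) h2 (Or.inr enorm_ne_top)
      rwa [mul_zero] at h3
    refine tendsto_of_tendsto_of_tendsto_of_le_of_le' tendsto_const_nhds hlim
      (Eventually.of_forall fun _ => zero_le) ?_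
    filter_upwards [self_mem_nhdsWithin] with h hh
    calc eLpNorm (fun x => v h x - A.indicator (fun _ => (1 : ℝ)) x) 2 (volume.restrict Ω)
        ≤ eLpNorm ((Metric.cthickening h S).indicator fun _ => C + 1) 2 (volume.restrict Ω) := by
          refine eLpNorm_mono_ae ?_
          rw [ae_restrict_iff' hΩ.1.measurableSet]
          filter_upwards [hae h hh] with x hx hxΩ
          by_cases hxS : x ∈ Metric.cthickening h S
          · rw [indicator_of_mem hxS, Real.norm_of_nonneg (by linarith : 0 ≤ C + 1)]
            refine (norm_sub_le _ _).trans (add_le_add ?_ ?_)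
            · exact (hC Ω A (T h) f (v h) hr (hT h hh) hf (hv h hh)).1 x (subset_closure hxΩ)
            · by_cases hxA : x ∈ A <;> simp [hxA]
          · rw [(hx hxΩ fun h' => hxS (closure_interfaceNhd_subset Ω A h h')).1]
            simp
      _ = ‖C + 1‖ₑ * (volume.restrict Ω) (Metric.cthickening h S) ^ (1 / (2 : ℝ)) := by
          rw [eLpNorm_indicator_const Metric.isClosed_cthickening.measurableSet (by simp) (by simp)]
          simp
      _ ≤ ‖C + 1‖ₑ * volume (Metric.cthickening h S) ^ (1 / (2 : ℝ)) := by
          gcongr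
          exact Measure.restrict_le_self
  · refine ⟨gradient (v h), hasWeakGradient_gradient hΩ.1 hΩb (hgrad h hh),
      memLp_gradient hΩ.1 hΩb (hgrad h hh) ∞, ?_⟩
    rw [ae_restrict_iff' (hΩ.1.measurableSet.diff isClosed_closure.measurableSet)]
    filter_upwards [hae h hh] with x hx hxU using (hx hxU.1 hxU.2).2
  · refine ⟨C * Λ, ?_⟩
    filter_upwards [self_mem_nhdsWithin] with h hh g hg
    have hh0 : 0 < h := hH hh
    have hbound : eLpNorm g ∞ (volume.restrict Ω) ≤ ENNReal.ofReal (C * (Λ / h)) := by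
      rw [eLpNorm_congr_ae
        (hg.ae_eq hΩ.1 (hasWeakGradient_gradient hΩ.1 hΩb (hgrad h hh))), eLpNorm_exponent_top]
      refine eLpNormEssSup_le_of_ae_bound ?_
      filter_upwards [ae_restrict_mem hΩ.1.measurableSet] with x hx
      refine (norm_gradient_le (hgrad h hh) hx).trans_eq (Real.coe_toNNReal _ (by positivity))
    refine (mul_le_mul_right hbound _).trans_eq ?_
    rw [← ENNReal.ofReal_mul hh0.le]
    congr 1
    field_simp
  · exact (hv h hh).exists_hasTraceOn hΩ (hT h hh) hr hAΩ hf (hH hh) (hdiam h hh) hΓ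

theorem isAdmissibleMethod_of_isFEInterpolant (hΩ : IsLipschitzDomain Ω)
    (hΩb : Bornology.IsBounded Ω) (hr : 1 ≤ r) (hH : H ⊆ Ioi 0)
    (hT : ∀ h ∈ H, IsSimplicialMesh Ω (T h)) (hsize : ∀ h ∈ H, HasMeshSize (T h) h)
    (hreg : IsRegularMeshFamily H T) (hqu : IsQuasiUniformMeshFamily H T)
    {I : ℝ → (EuclideanSpace ℝ (Fin d) → ℝ) → (EuclideanSpace ℝ (Fin d) → ℝ)}
    (hI : ∀ h ∈ H, ∀ w, IsFEInterpolant Ω (T h) r w (I h w)) :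
    IsAdmissibleMethod Ω H (fun h => feSpace Ω (T h) r) I where
  index_pos := hH
  conforming h hh _ hv := memH1_of_mem_feSpace hr hΩ.1 hΩb (hT h hh) hv
  mem_space h hh w := (hI h hh w).1
  linear h hh := isLinearMap_of_isFEInterpolant hr (hT h hh) (hI h hh)
  conditions _ hA hAΩ f hf := admissibleConditions_of_isFEInterpolant hΩ hΩb hr hH hT hsize hreg hqu
    hA hAΩ hf fun h hh => hI h hh f

end Admissible

/-! ### Piecewise constant media -/

section Media

variable {d : ℕ} {Ω A : Set (EuclideanSpace ℝ (Fin d))}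

lemma isIndicatorExtension_indicator_closure (Ω A : Set (EuclideanSpace ℝ (Fin d))) :
    IsIndicatorExtension Ω A ((closure A).indicator 1) := by
  intro x hx
  by_cases h : x ∈ closure A
  · exact Or.inl ⟨by simp [h], h⟩
  · refine Or.inr ⟨by simp [h], ?_⟩
    rw [mem_closure_iff_nhds]
    intro t ht
    obtain ⟨y, ⟨hyt, hyA⟩, hyΩ⟩ := mem_closure_iff_nhds.1 hx (t ∩ (closure A)ᶜ)
      (inter_mem ht (isClosed_closure.isOpen_compl.mem_nhds h))
    exact ⟨y, hyt, hyΩ, hyA⟩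

/-- If `χ_A` has the value `c` at points of `Ω` off `∂A` which are arbitrarily close to `x`, then an
extension of `χ_A` may have the value `c` at `x`. -/
lemma indicator_value_of_mem_closure {S : Set (EuclideanSpace ℝ (Fin d))} (hSΩ : S ⊆ Ω)
    (hSA : Disjoint S (frontier A)) {c : ℝ}
    (hc : ∀ y ∈ S, A.indicator (1 : EuclideanSpace ℝ (Fin d) → ℝ) y = c)
    {x : EuclideanSpace ℝ (Fin d)} (hx : x ∈ closure S) :
    (c = 1 ∧ x ∈ closure A) ∨ (c = 0 ∧ x ∈ closure (Ω \ closure A)) := by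
  obtain ⟨y₀, hy₀⟩ := closure_nonempty_iff.1 ⟨x, hx⟩
  by_cases h : y₀ ∈ A
  · have hc1 : c = 1 := by rw [← hc y₀ hy₀]; simp [h]
    refine Or.inl ⟨hc1, closure_mono (fun y hy => ?_) hx⟩
    by_contra hyA
    have := hc y hy
    simp [hyA, hc1] at this
  · have hc0 : c = 0 := by rw [← hc y₀ hy₀]; simp [h]
    have hyA : ∀ y ∈ S, y ∉ A := fun y hy hyA => by
      have := hc y hy
      simp [hyA, hc0] at this
    have hsub : S ⊆ Ω \ closure A := fun y hy => ⟨hSΩ hy, fun h' =>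
      Set.disjoint_left.1 hSA hy ⟨h', fun h'' => hyA y hy (interior_subset h'')⟩⟩
    exact Or.inr ⟨hc0, closure_mono hsub hx⟩

/-- Both kinds of extensions of a piecewise constant medium are combinations of extensions of the
characteristic functions. For the first kind, only finitely many patterns of membership in the
subdomains are possible, hence one of them occurs, together with the given value, arbitrarily close
to a given point; it provides the values of the extensions at this point. -/
theorem PiecewiseConstantMedium.exists_extensions (u : PiecewiseConstantMedium Ω)
    {f : EuclideanSpace ℝ (Fin d) → ℝ} (hf : u.IsNeighbourExtension f ∨ u.IsClosureExtension f) :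
    ∃ (b : Fin u.M → EuclideanSpace ℝ (Fin d) → ℝ) (a : Fin u.K → EuclideanSpace ℝ (Fin d) → ℝ),
      (∀ m, IsIndicatorExtension Ω (u.bg m) (b m)) ∧
      (∀ k, IsIndicatorExtension Ω (u.incl k) (a k)) ∧
      EqOn f (u.combine b a) (closure Ω) := by
  classical
  rcases hf with hf | hf
  · have key : ∀ x ∈ closure Ω, ∃ y, u.val y = f x ∧
        x ∈ closure {z | z ∈ Ω \ u.interfaces ∧ (∀ m, z ∈ u.bg m ↔ y ∈ u.bg m) ∧
          ∀ k, z ∈ u.incl k ↔ y ∈ u.incl k} := by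
      intro x hx
      have hx' := hf x hx
      set pat : EuclideanSpace ℝ (Fin d) → Set (Fin u.M) × Set (Fin u.K) :=
        fun y => ({m | y ∈ u.bg m}, {k | y ∈ u.incl k}) with hpat
      have hU : {y | y ∈ Ω \ u.interfaces ∧ u.val y = f x} =
          ⋃ P, {y | (y ∈ Ω \ u.interfaces ∧ u.val y = f x) ∧ pat y = P} := by
        ext y; simp
      rw [hU, closure_iUnion_of_finite] at hx'
      obtain ⟨P, hP⟩ := mem_iUnion.1 hx'
      obtain ⟨y, hy, hyP⟩ := closure_nonempty_iff.1 ⟨x, hP⟩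
      refine ⟨y, hy.2, closure_mono ?_ hP⟩
      rintro z ⟨hz, hzP⟩
      rw [← hyP, Prod.mk.injEq] at hzP
      exact ⟨hz.1, fun m => Set.ext_iff.1 hzP.1 m, fun k => Set.ext_iff.1 hzP.2 k⟩
    choose! y hy hyx using key
    refine ⟨fun m x => (u.bg m).indicator 1 (y x), fun k x => (u.incl k).indicator 1 (y x),
      fun m x hx => ?_, fun k x hx => ?_, fun x hx => ?_⟩
    · refine indicator_value_of_mem_closure (fun z hz => hz.1.1)
        (Set.disjoint_left.2 fun z hz hzA => hz.1.2 (Or.inl (mem_iUnion.2 ⟨m, hzA⟩)))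
        (fun z hz => ?_) (hyx x hx)
      simp only [indicator_apply, hz.2.1 m]
      rfl
    · refine indicator_value_of_mem_closure (fun z hz => hz.1.1)
        (Set.disjoint_left.2 fun z hz hzA => hz.1.2 (Or.inr (mem_iUnion.2 ⟨k, hzA⟩)))
        (fun z hz => ?_) (hyx x hx)
      simp only [indicator_apply, hz.2.2 k]
      rfl
    · rw [← hy x hx]
      simp [PiecewiseConstantMedium.val, PiecewiseConstantMedium.combine]
  · exact ⟨_, _, fun m => isIndicatorExtension_indicator_closure Ω (u.bg m),
      fun k => isIndicatorExtension_indicator_closure Ω (u.incl k), hf⟩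

lemma IsFEInterpolant.combine {r : ℕ}
    {T : Geometry.SimplicialComplex ℝ (EuclideanSpace ℝ (Fin d))} (u : PiecewiseConstantMedium Ω)
    {b b' : Fin u.M → EuclideanSpace ℝ (Fin d) → ℝ} {a a' : Fin u.K → EuclideanSpace ℝ (Fin d) → ℝ}
    (hb : ∀ m, IsFEInterpolant Ω T r (b m) (b' m)) (ha : ∀ k, IsFEInterpolant Ω T r (a k) (a' k)) :
    IsFEInterpolant Ω T r (u.combine b a) (u.combine b' a') :=
  (IsFEInterpolant.sum _ fun m _ => (hb m).smul _).add
    (IsFEInterpolant.sum _ fun k _ => (ha k).smul _)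

end Media

/-! ### Interpolation is an admissible method -/

theorem proposition2p2 {d : ℕ} (hd : 2 ≤ d) (Ω : Set (EuclideanSpace ℝ (Fin d)))
    (hΩ : IsLipschitzDomain Ω) (hΩb : Bornology.IsBounded Ω) (r : ℕ) (hr : 1 ≤ r)
    (H : Set ℝ) (hH : H ⊆ Ioi 0)
    (T : ℝ → Geometry.SimplicialComplex ℝ (EuclideanSpace ℝ (Fin d)))
    (hT : ∀ h ∈ H, IsSimplicialMesh Ω (T h)) (hsize : ∀ h ∈ H, HasMeshSize (T h) h)
    (hreg : IsRegularMeshFamily H T) (hqu : IsQuasiUniformMeshFamily H T) :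
    -- the interpolant of every function exists and is unique
    (∀ h ∈ H, ∀ w, ∃! v, IsFEInterpolant Ω (T h) r w v) ∧
    -- interpolation is an admissible method with `δ = h`
    (∀ I : ℝ → (EuclideanSpace ℝ (Fin d) → ℝ) → (EuclideanSpace ℝ (Fin d) → ℝ),
      (∀ h ∈ H, ∀ w, IsFEInterpolant Ω (T h) r w (I h w)) →
        IsAdmissibleMethod Ω H (fun h => feSpace Ω (T h) r) I) ∧
    -- the interpolant of a piecewise constant medium, extended in one of the two ways, is an
    -- admissible approximation of it with `δ = h`
    (∀ (u : PiecewiseConstantMedium Ω) (f : EuclideanSpace ℝ (Fin d) → ℝ),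
      u.IsNeighbourExtension f ∨ u.IsClosureExtension f →
      ∀ uh : ℝ → EuclideanSpace ℝ (Fin d) → ℝ,
        (∀ h ∈ H, IsFEInterpolant Ω (T h) r f (uh h)) →
          u.IsAdmissibleApproximation H (fun h => feSpace Ω (T h) r) uh) := by
  have hadm := fun I hI => isAdmissibleMethod_of_isFEInterpolant (I := I) hΩ hΩb hr hH hT hsize
    hreg hqu hI
  refine ⟨fun h hh w => existsUnique_isFEInterpolant hr (hT h hh) w, hadm, ?_⟩
  intro u f hf uh huh
  obtain ⟨b, a, hb, ha, hfe⟩ := u.exists_extensions hf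
  choose! I hI using fun h (hh : h ∈ H) w => exists_isFEInterpolant hr (hT h hh) w
  exact ⟨I, hadm I hI, b, a, hb, ha, fun h hh => (huh h hh).eq_of_eqOn hr (hT h hh)
    (IsFEInterpolant.combine u (fun m => hI h hh (b m)) fun k => hI h hh (a k)) hfe⟩
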